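/- Let $\Omega\subset\mathbb{R}^d$, $d\ge 1$, be a nonempty, bounded, open set and let $T>0$. Let $H^1_0(\Omega)$ be the closure of $C_0^\infty(\Omega)$ in $H^1(\Omega)$, and let $H^{-1}(\Omega)$ be its dual space, with norm $\|\Phi\|_{H^{-1}(\Omega)}=\sup_{v\in H^1_0(\Omega)\setminus\{0\}}\langle\Phi,v\rangle/\|\nabla v\|_\Omega$, where $\|\cdot\|_\Omega$ and $(\cdot,\cdot)_\Omega$ are the norm and inner product of $L^2(\Omega)$; $L^2(\Omega)$ is embedded in $H^{-1}(\Omega)$ by $\langle w,v\rangle=(w,v)_\Omega$. Let $X=L^2(0,T;H^1_0(\Omega))$ with $\|v\|_X^2=\int_0^T\|\nabla v\|_\Omega^2\,dt$, and let $Y=L^2(0,T;H^1_0(\Omega))\cap H^1(0,T;H^{-1}(\Omega))$, which embeds continuously into $C([0,T];L^2(\Omega))$, with $$\|\varphi\|_Y^2=\int_0^T\left(\|\partial_t\varphi\|_{H^{-1}(\Omega)}^2+\|\nabla\varphi\|_\Omega^2\right)dt+\|\varphi(T)\|_\Omega^2 .$$ Let $f\in L^2(0,T;H^{-1}(\Omega))$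 and $u_0\in H^1_0(\Omega)$, and let $u\in Y$ be the weak solution of the heat equation: $u(0)=u_0$ and, for all $v\in H^1_0(\Omega)$, $\langle\partial_t u(t),v\rangle+(\nabla u(t),\nabla v)_\Omega=\langle f(t),v\rangle$ for a.e. $t\in(0,T)$. Let $0=t_0<t_1<\dots<t_N=T$, $N\ge1$, $\tau_n=t_n-t_{n-1}$, let $f_1,\dots,f_N\in H^{-1}(\Omega)$ be arbitrary, and let $u_1,\dots,u_N\in H^1_0(\Omega)$ be the implicit Euler approximations starting from $u_0$, i.e. for each $n\in\{1,\dots,N\}$ $$\left(\frac{u_n-u_{n-1}}{\tau_n},v\right)_\Omega+(\nabla u_n,\nabla v)_\Omega=\langle f_n,v\rangle\qquad\forall v\in H^1_0(\Omega).$$ Let $f_\tau(t)=f_n$ for $t\in(t_{n-1},t_n)$. Let $u_\tau$ be the left-continuous piecewise constant function with $u_\tau(0)=u_0$ and $u_\tau(t)=u_n$ for $t\in(t_{n-1},t_n]$, and let $U_\tau$ be the continuous piecewise affine function with $U_\tau(t)=\frac{t-t_{n-1}}{\tau_n}u_n+\frac{t_n-t}{\tau_n}u_{n-1}$ for $t\in[t_{n-1},t_n]$,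 $n=1,\dots,N$. Set $$\eta_J=\|u_\tau-U_\tau\|_X,\qquad \|f-f_\tau\|_{L^2(0,T;H^{-1}(\Omega))}=\left(\int_0^T\|f-f_\tau\|_{H^{-1}(\Omega)}^2\,dt\right)^{1/2}.$$ Then $u_\tau-U_\tau\in X$, $u-U_\tau\in Y$ (with a representative in $C([0,T];L^2(\Omega))$), $f-f_\tau\in L^2(0,T;H^{-1}(\Omega))$, and $$\|u-U_\tau\|_Y\le \eta_J+\|f-f_\tau\|_{L^2(0,T;H^{-1}(\Omega))},\qquad \eta_J\le\|u-U_\tau\|_Y+\|f-f_\tau\|_{L^2(0,T;H^{-1}(\Omega))}.$$ -/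

import Mathlib

open MeasureTheory Set
open scoped ContDiff

noncomputable section

namespace HeatEuler

/-- The space `ℝ^d` with its Euclidean norm. -/
abbrev Sp (d : ℕ) : Type := EuclideanSpace ℝ (Fin d)

/-- Test functions `φ ∈ C₀^∞(U)`: smooth, with compact support contained in `U`. -/
structure IsTest {E : Type*} [NormedAddCommGroup E] [NormedSpace ℝ E] (U : Set E)
    (φ : E → ℝ) : Prop where
  smooth : ContDiff ℝ ∞ φ
  compact : HasCompactSupport φ
  supp : tsupport φ ⊆ U

section Spatial

variable {d : ℕ}

/-- The partial derivative `∂φ/∂x_i`. -/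
def partialD (φ : Sp d → ℝ) (i : Fin d) (x : Sp d) : ℝ :=
  fderiv ℝ φ x (EuclideanSpace.single i 1)

/-- `L²(Ω)`. -/
abbrev L2 (Ω : Set (Sp d)) : Type := Lp ℝ 2 (volume.restrict Ω)

/-- `L²(Ω; ℝ^d)`. -/
abbrev L2Vec (Ω : Set (Sp d)) : Type := Lp (Sp d) 2 (volume.restrict Ω)

/-- `g` is the weak gradient of `v` in `Ω`. -/
def IsWeakGrad (Ω : Set (Sp d)) (v : L2 Ω) (g : L2Vec Ω) : Prop :=
  ∀ i : Fin d, ∀ φ : Sp d → ℝ, IsTest Ω φ →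
    ∫ x in Ω, v x * partialD φ i x = -∫ x in Ω, g x i * φ x

theorem IsTest.memLp {Ω : Set (Sp d)} {φ : Sp d → ℝ} (h : IsTest Ω φ) :
    MemLp φ 2 (volume.restrict Ω) :=
  (h.smooth.continuous.memLp_of_hasCompactSupport h.compact).restrict Ω

theorem IsTest.memLp_partialD {Ω : Set (Sp d)} {φ : Sp d → ℝ} (h : IsTest Ω φ) (i : Fin d) :
    MemLp (partialD φ i) 2 (volume.restrict Ω) := by
  have h1 : Continuous (partialD φ i) :=
    (h.smooth.continuous_fderiv (by simp)).clm_apply continuous_const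
  have h2 : HasCompactSupport (partialD φ i) := h.compact.fderiv_apply ℝ _
  exact (h1.memLp_of_hasCompactSupport h2).restrict Ω

theorem memLp_coord {Ω : Set (Sp d)} (g : L2Vec Ω) (i : Fin d) :
    MemLp (fun x => g x i) 2 (volume.restrict Ω) :=
  ((EuclideanSpace.proj i : Sp d →L[ℝ] ℝ).comp_memLp' (Lp.memLp g))

theorem IsWeakGrad.zero (Ω : Set (Sp d)) : IsWeakGrad Ω 0 0 := by
  intro i φ _
  have h1 : ∫ x in Ω, (0 : L2 Ω) x * partialD φ i x = 0 := by
    refine integral_eq_zero_of_ae ?_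
    filter_upwards [Lp.coeFn_zero ℝ 2 (volume.restrict Ω)] with x hx
    rw [hx]
    simp
  have h2 : ∫ x in Ω, (0 : L2Vec Ω) x i * φ x = 0 := by
    refine integral_eq_zero_of_ae ?_
    filter_upwards [Lp.coeFn_zero (Sp d) 2 (volume.restrict Ω)] with x hx
    rw [hx]
    simp
  rw [h1, h2, neg_zero]

theorem IsWeakGrad.add {Ω : Set (Sp d)} {v w : L2 Ω} {g k : L2Vec Ω}
    (hv : IsWeakGrad Ω v g) (hw : IsWeakGrad Ω w k) : IsWeakGrad Ω (v + w) (g + k) := by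
  intro i φ hφ
  have h1 : ∫ x in Ω, (v + w) x * partialD φ i x
      = (∫ x in Ω, v x * partialD φ i x) + ∫ x in Ω, w x * partialD φ i x := by
    refine Eq.trans ?_ (integral_add ((Lp.memLp v).integrable_mul (hφ.memLp_partialD i))
      ((Lp.memLp w).integrable_mul (hφ.memLp_partialD i)))
    refine integral_congr_ae ?_
    filter_upwards [Lp.coeFn_add v w] with x hx
    simp only [hx, Pi.add_apply, add_mul]
  have h2 : ∫ x in Ω, (g + k) x i * φ x
      = (∫ x in Ω, g x i * φ x) + ∫ x in Ω, k x i * φ x := by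
    refine Eq.trans ?_ (integral_add ((memLp_coord g i).integrable_mul hφ.memLp)
      ((memLp_coord k i).integrable_mul hφ.memLp))
    refine integral_congr_ae ?_
    filter_upwards [Lp.coeFn_add g k] with x hx
    simp only [hx, Pi.add_apply, PiLp.add_apply, add_mul]
  rw [h1, h2, hv i φ hφ, hw i φ hφ]
  ring

theorem IsWeakGrad.smul {Ω : Set (Sp d)} {v : L2 Ω} {g : L2Vec Ω} (c : ℝ)
    (hv : IsWeakGrad Ω v g) : IsWeakGrad Ω (c • v) (c • g) := by
  intro i φ hφ
  have h1 : ∫ x in Ω, (c • v) x * partialD φ i x = c * ∫ x in Ω, v x * partialD φ i x := by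
    rw [← integral_const_mul]
    refine integral_congr_ae ?_
    filter_upwards [Lp.coeFn_smul c v] with x hx
    simp [hx, mul_assoc]
  have h2 : ∫ x in Ω, (c • g) x i * φ x = c * ∫ x in Ω, g x i * φ x := by
    rw [← integral_const_mul]
    refine integral_congr_ae ?_
    filter_upwards [Lp.coeFn_smul c g] with x hx
    simp [hx, mul_assoc]
  rw [h1, h2, hv i φ hφ]
  ring

/-- `H¹(Ω)`: the pairs `(v, ∇v)` with `v ∈ L²(Ω)` and weak gradient `∇v ∈ L²(Ω; ℝ^d)`. The norm
inherited from the `ℓ²`-product satisfies `‖v‖²_{H¹} = ‖v‖²_Ω + ‖∇v‖²_Ω`. -/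
def H1 (Ω : Set (Sp d)) : Submodule ℝ (WithLp 2 (L2 Ω × L2Vec Ω)) where
  carrier := {p | IsWeakGrad Ω p.fst p.snd}
  zero_mem' := IsWeakGrad.zero Ω
  add_mem' := fun hp hq => IsWeakGrad.add hp hq
  smul_mem' := fun c _ hp => IsWeakGrad.smul c hp

/-- The elements of `H¹(Ω)` that are (represented by) functions in `C₀^∞(Ω)`. -/
def testSubmodule (Ω : Set (Sp d)) : Submodule ℝ (H1 Ω) where
  carrier := {v | ∃ φ : Sp d → ℝ, IsTest Ω φ ∧ v.1.fst =ᵐ[volume.restrict Ω] φ}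
  zero_mem' := ⟨0, ⟨contDiff_const, HasCompactSupport.zero, by simp [tsupport]⟩,
    Lp.coeFn_zero ℝ 2 (volume.restrict Ω)⟩
  add_mem' := by
    rintro v w ⟨φ, hφ, hv⟩ ⟨ψ, hψ, hw⟩
    refine ⟨φ + ψ, ⟨hφ.smooth.add hψ.smooth, hφ.compact.add hψ.compact,
      (tsupport_add φ ψ).trans (union_subset hφ.supp hψ.supp)⟩, ?_⟩
    exact (Lp.coeFn_add v.1.fst w.1.fst).trans (hv.add hw)
  smul_mem' := by
    rintro c v ⟨φ, hφ, hv⟩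
    refine ⟨c • φ, ⟨contDiff_const.smul hφ.smooth,
      hφ.compact.mono (Function.support_const_smul_subset c φ),
      (closure_mono (Function.support_const_smul_subset c φ)).trans hφ.supp⟩, ?_⟩
    exact (Lp.coeFn_smul c v.1.fst).trans (hv.const_smul c)

/-- `H¹₀(Ω)`: the closure of `C₀^∞(Ω)` in `H¹(Ω)`. -/
def H10 (Ω : Set (Sp d)) : Submodule ℝ (H1 Ω) := (testSubmodule Ω).topologicalClosure

/-- The inclusion `H¹₀(Ω) → L²(Ω)`. -/
def toL2 (Ω : Set (Sp d)) : H10 Ω →L[ℝ] L2 Ω :=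
  (WithLp.fstL 2 ℝ (L2 Ω) (L2Vec Ω)).comp ((H1 Ω).subtypeL.comp (H10 Ω).subtypeL)

/-- The gradient `∇ : H¹₀(Ω) → L²(Ω; ℝ^d)`. -/
def grad (Ω : Set (Sp d)) : H10 Ω →L[ℝ] L2Vec Ω :=
  (WithLp.sndL 2 ℝ (L2 Ω) (L2Vec Ω)).comp ((H1 Ω).subtypeL.comp (H10 Ω).subtypeL)

/-- `H⁻¹(Ω)`, the dual space of `H¹₀(Ω)`. Its norm is `dualNorm` below; the operator norm with
respect to the full `H¹`-norm, which Mathlib provides, is only used for the topology, measurability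
and square integrability (on a bounded set the two norms are equivalent). -/
abbrev Hm1 (Ω : Set (Sp d)) : Type := StrongDual ℝ (H10 Ω)

/-- `‖Φ‖_{H⁻¹(Ω)} = sup_{v ≠ 0} ⟨Φ, v⟩ / ‖∇v‖_Ω`. -/
def dualNorm {Ω : Set (Sp d)} (Φ : Hm1 Ω) : ℝ :=
  sSup {r : ℝ | ∃ v : H10 Ω, v ≠ 0 ∧ r = Φ v / ‖grad Ω v‖}

/-- The embedding `L²(Ω) → H⁻¹(Ω)`, `⟨g, v⟩ = (g, v)_Ω`. -/
def l2ToHm1 {Ω : Set (Sp d)} (g : L2 Ω) : Hm1 Ω := (innerSL ℝ g).comp (toL2 Ω)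

end Spatial

section Bochner

/-- `φ ∈ L²(0,T;V)` (for a representative `φ`). -/
def MemL2 {V : Type*} [NormedAddCommGroup V] (T : ℝ) (φ : ℝ → V) : Prop :=
  MemLp φ 2 (volume.restrict (Ioo 0 T))

/-- `w` is the weak derivative of `φ` on `(0,T)`. -/
def IsWeakDeriv {V : Type*} [NormedAddCommGroup V] [NormedSpace ℝ V] (T : ℝ) (φ w : ℝ → V) :
    Prop :=
  ∀ η : ℝ → ℝ, IsTest (Ioo 0 T) η →
    ∫ t in Ioo 0 T, deriv η t • φ t = -∫ t in Ioo 0 T, η t • w t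

variable {d : ℕ} {Ω : Set (Sp d)}

/-- `w ∈ L²(0,T;H⁻¹(Ω))` is the weak time derivative of the `H¹₀(Ω)`-valued function `φ`, regarded
as an `H⁻¹(Ω)`-valued function. -/
def IsTimeDeriv (T : ℝ) (φ : ℝ → H10 Ω) (w : ℝ → Hm1 Ω) : Prop :=
  MemL2 T w ∧ IsWeakDeriv T (fun t => l2ToHm1 (toL2 Ω (φ t))) w

/-- `Y = L²(0,T;H¹₀(Ω)) ∩ H¹(0,T;H⁻¹(Ω))`. -/
def MemY (T : ℝ) (φ : ℝ → H10 Ω) : Prop :=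
  MemL2 T φ ∧ ∃ w : ℝ → Hm1 Ω, IsTimeDeriv T φ w

open Classical in
/-- The weak time derivative `∂_t φ` of `φ ∈ Y` (unique up to a null set). -/
def timeDeriv (T : ℝ) (φ : ℝ → H10 Ω) : ℝ → Hm1 Ω :=
  if h : ∃ w : ℝ → Hm1 Ω, IsTimeDeriv T φ w then h.choose else 0

/-- `c` is a representative of `φ` in `C([0,T]; L²(Ω))`. -/
def IsContRep (T : ℝ) (φ : ℝ → H10 Ω) (c : ℝ → L2 Ω) : Prop :=
  ContinuousOn c (Icc 0 T) ∧ ∀ᵐ t ∂(volume.restrict (Ioo 0 T)), c t = toL2 Ω (φ t)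

open Classical in
/-- The value `φ(t) ∈ L²(Ω)`, `t ∈ [0,T]`, of the continuous representative of `φ ∈ Y` (which exists
because `Y` embeds into `C([0,T]; L²(Ω))`, and is unique on `[0,T]`). -/
def valueAt (T : ℝ) (φ : ℝ → H10 Ω) (t : ℝ) : L2 Ω :=
  if h : ∃ c : ℝ → L2 Ω, IsContRep T φ c then h.choose t else 0

/-- `‖φ‖_X = (∫₀ᵀ ‖∇φ‖²_Ω dt)^{1/2}`. -/
def normX (T : ℝ) (φ : ℝ → H10 Ω) : ℝ :=
  Real.sqrt (∫ t in Ioo 0 T, ‖grad Ω (φ t)‖ ^ 2)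

/-- `‖g‖_{L²(0,T;H⁻¹(Ω))} = (∫₀ᵀ ‖g‖²_{H⁻¹(Ω)} dt)^{1/2}`. -/
def normL2Hm1 (T : ℝ) (g : ℝ → Hm1 Ω) : ℝ :=
  Real.sqrt (∫ t in Ioo 0 T, dualNorm (g t) ^ 2)

/-- `‖φ‖_Y = (∫₀ᵀ (‖∂_t φ‖²_{H⁻¹(Ω)} + ‖∇φ‖²_Ω) dt + ‖φ(T)‖²_Ω)^{1/2}`. -/
def normY (T : ℝ) (φ : ℝ → H10 Ω) : ℝ :=
  Real.sqrt ((∫ t in Ioo 0 T, (dualNorm (timeDeriv T φ t) ^ 2 + ‖grad Ω (φ t)‖ ^ 2))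
    + ‖valueAt T φ T‖ ^ 2)

/-- `u ∈ Y` is the weak solution of `∂_t u - Δu = f` in `Ω × (0,T)`, `u = 0` on `∂Ω × (0,T)`,
`u(0) = u₀`. -/
structure IsWeakSolution (T : ℝ) (f : ℝ → Hm1 Ω) (u₀ : L2 Ω) (u : ℝ → H10 Ω) : Prop where
  memY : MemY T u
  eqn : ∀ v : H10 Ω, ∀ᵐ t ∂(volume.restrict (Ioo 0 T)),
    timeDeriv T u t v + inner ℝ (grad Ω (u t)) (grad Ω v) = f t v
  init : valueAt T u 0 = u₀

end Bochner

section Euler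

/-- `0 = t_0 < t_1 < ⋯ < t_N = T`; only the indices `0, …, N` matter. -/
structure IsPartition (N : ℕ) (T : ℝ) (t : ℕ → ℝ) : Prop where
  zero : t 0 = 0
  last : t N = T
  lt : ∀ n < N, t n < t (n + 1)

variable {V : Type*} [AddCommGroup V]

/-- The function equal to `w_n` on `(t_{n-1}, t_n]`, for `n = 1, …, N` (and to `0` elsewhere). -/
def pwConst (N : ℕ) (t : ℕ → ℝ) (w : ℕ → V) (s : ℝ) : V :=
  ∑ n ∈ Finset.range N, (Ioc (t n) (t (n + 1))).indicator (fun _ => w (n + 1)) s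

/-- The left-continuous piecewise constant reconstruction `u_τ`: equal to `u_n` on `(t_{n-1}, t_n]`
for `n = 1, …, N`, and to `u_0` at `t_0`. -/
def constRecon (N : ℕ) (t : ℕ → ℝ) (u : ℕ → V) : ℝ → V :=
  Function.update (pwConst N t u) (t 0) (u 0)

/-- The continuous piecewise affine reconstruction `U_τ`: equal to `u_0` at `t_0` and to
`(s - t_{n-1})/τ_n u_n + (t_n - s)/τ_n u_{n-1}` for `s ∈ (t_{n-1}, t_n]`, `n = 1, …, N`, where
`τ_n = t_n - t_{n-1}`. -/
def affineRecon [Module ℝ V] (N : ℕ) (t : ℕ → ℝ) (u : ℕ → V) : ℝ → V :=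
  Function.update
    (fun s => ∑ n ∈ Finset.range N, (Ioc (t n) (t (n + 1))).indicator
      (fun r => ((r - t n) / (t (n + 1) - t n)) • u (n + 1)
        + ((t (n + 1) - r) / (t (n + 1) - t n)) • u n) s)
    (t 0) (u 0)

/-- `u_0, …, u_N ∈ H¹₀(Ω)` are the implicit Euler approximations for the right-hand sides
`f_1, …, f_N ∈ H⁻¹(Ω)`: for `n = 1, …, N` and all `v ∈ H¹₀(Ω)`,
`((u_n - u_{n-1})/τ_n, v)_Ω + (∇u_n, ∇v)_Ω = ⟨f_n, v⟩`. -/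
def IsImplicitEuler {d : ℕ} {Ω : Set (Sp d)} (N : ℕ) (t : ℕ → ℝ) (fn : ℕ → Hm1 Ω)
    (un : ℕ → H10 Ω) : Prop :=
  ∀ n < N, ∀ v : H10 Ω,
    inner ℝ (toL2 Ω ((t (n + 1) - t n)⁻¹ • (un (n + 1) - un n))) (toL2 Ω v)
      + inner ℝ (grad Ω (un (n + 1))) (grad Ω v) = fn (n + 1) v

end Euler

end HeatEuler

end

open HeatEuler

noncomputable section

namespace HeatEuler

open Filter Topology

/-! ### Vector-valued calculus on an interval: absolute continuity, weak derivatives, du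
Bois-Reymond. -/

section Calculus

variable {E F : Type*} [NormedAddCommGroup E] [NormedAddCommGroup F]

/-! Put e = u - U_τ, j = u_τ - U_τ, F = f - f_τ, and let R : H⁻¹ → H¹₀ be the Riesz map of the form
(∇·,∇·), so that the dual norm of Φ is ‖∇RΦ‖. Since ∂_t U_τ is the difference quotient, subtracting
the Euler equation from the heat equation gives R∂_t e + e = j + RF for a.e. time. Expanding the
square, ‖∇(R∂_t e + e)‖² = ‖∂_t e‖² + ‖∇e‖² + 2⟨∂_t e, e⟩, and the last term integrates to ‖e(T)‖²
because e(0) = 0. So ‖e‖_Y is exactly the L² norm in time of ∇(j + RF), and both bounds are the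
triangle inequality.

The argument runs in an abstract setting: an injective i : V → H and a coercive g : V → K, in place
of the inclusion into L² and the gradient. Its three supports are the energy identity
`exists_continuous_rep_energy`, the Riesz map `formRiesz` with `sSup_dual_eq_norm_formRiesz`, and
the weak derivative `isWeakDeriv_affineRecon` of U_τ. They are combined in
`IsDualDeriv.sqrt_eq_residual` and `euler_error_bounds`. The concrete spaces enter only through the
completeness of H¹₀, `injective_toL2` and the Poincaré inequality behind `exists_coercive_grad`.

The energy identity is proved by a resolvent regularisation. Identifying V' with V turns the
embedding V → V' into S = i*i, so Sφ has a V-valued primitive ψ as representative. Applying (S +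
ε)⁻¹ to ψ gives functions to which the classical chain rule applies, and they converge uniformly in
H after applying i. -/

theorem _root_.AbsolutelyContinuousOnInterval.of_dist_le {f : ℝ → E} {g : ℝ → F} {a b : ℝ}
    (hf : AbsolutelyContinuousOnInterval f a b)
    (h : ∀ x ∈ uIcc a b, ∀ y ∈ uIcc a b, dist (g x) (g y) ≤ dist (f x) (f y)) :
    AbsolutelyContinuousOnInterval g a b := by
  rw [absolutelyContinuousOnInterval_iff] at hf ⊢
  intro ε hε
  obtain ⟨δ, hδ, H⟩ := hf ε hε
  refine ⟨δ, hδ, fun P hP hPδ => lt_of_le_of_lt (Finset.sum_le_sum fun i hi => ?_) (H P hP hPδ)⟩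
  have := hP.1 i hi
  exact h _ this.1 _ this.2

theorem _root_.AbsolutelyContinuousOnInterval.norm_sq {f : ℝ → E} {a b : ℝ}
    (hf : AbsolutelyContinuousOnInterval f a b) :
    AbsolutelyContinuousOnInterval (fun t => ‖f t‖ ^ 2) a b := by
  have h1 : AbsolutelyContinuousOnInterval (fun t => ‖f t‖) a b :=
    hf.of_dist_le fun x _ y _ => by
      rw [dist_eq_norm (f x)]; exact dist_norm_norm_le _ _
  simpa only [sq] using! h1.fun_mul h1

theorem intervalIntegrable_of_memL2 {T : ℝ} (hT : 0 < T) {φ : ℝ → E} (h : MemL2 T φ) :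
    IntervalIntegrable φ volume 0 T := by
  rw [intervalIntegrable_iff_integrableOn_Ioo_of_le hT.le]
  exact h.integrable (by norm_num)

theorem integrable_of_memL2 {T : ℝ} {φ : ℝ → E} (h : MemL2 T φ) :
    Integrable φ (volume.restrict (Ioo 0 T)) :=
  h.integrable (by norm_num)

variable [NormedSpace ℝ E] [NormedSpace ℝ F]

/-- Increments of the primitive are dominated by those of the scalar primitive of ‖k‖. -/
theorem _root_.IntervalIntegrable.absolutelyContinuousOnInterval_primitive {k : ℝ → E} {a b : ℝ}
    (hk : IntervalIntegrable k volume a b) :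
    AbsolutelyContinuousOnInterval (fun t => ∫ s in a..t, k s) a b := by
  refine (hk.norm.absolutelyContinuousOnInterval_intervalIntegral
    (left_mem_uIcc (a := a))).of_dist_le fun x hx y hy => ?_
  have hax := hk.mono_set (uIcc_subset_uIcc left_mem_uIcc hx)
  have hay := hk.mono_set (uIcc_subset_uIcc left_mem_uIcc hy)
  rw [dist_eq_norm, dist_eq_norm, intervalIntegral.integral_interval_sub_left hax hay,
    intervalIntegral.integral_interval_sub_left hax.norm hay.norm]
  exact intervalIntegral.norm_integral_le_abs_integral_norm

/-- The difference of f and the primitive of k is absolutely continuous with derivative zero a.e.,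
hence constant. The derivative of f is assumed to exist, since E need not have the Radon–Nikodym
property. -/
theorem integral_eq_sub_of_absolutelyContinuous [CompleteSpace E] {f k : ℝ → E} {a b : ℝ}
    (hf : AbsolutelyContinuousOnInterval f a b) (hk : IntervalIntegrable k volume a b)
    (h : ∀ᵐ x, x ∈ uIcc a b → HasDerivAt f (k x) x) : ∫ t in a..b, k t = f b - f a := by
  have hg := hf.fun_sub hk.absolutelyContinuousOnInterval_primitive
  have h0 : ∀ᵐ x, x ∈ uIcc a b → HasDerivAt (fun t => f t - ∫ s in a..t, k s) 0 x := by
    filter_upwards [h, hk.ae_hasDerivAt_integral] with x h1 h2 hx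
    simpa using (h1 hx).fun_sub (h2 hx a left_mem_uIcc)
  obtain ⟨C, hC⟩ := hg.const_of_ae_hasDerivAt_zero h0
  have h1 := hC a left_mem_uIcc
  have h2 := hC b right_mem_uIcc
  simp only [intervalIntegral.integral_same, sub_zero] at h1
  rw [h1, ← h2]
  abel

theorem integral_Ioo_eq_interval {T : ℝ} (hT : 0 < T) (φ : ℝ → E) :
    ∫ t in Ioo 0 T, φ t = ∫ t in (0 : ℝ)..T, φ t := by
  rw [intervalIntegral.integral_of_le hT.le, integral_Ioc_eq_integral_Ioo]

theorem IsTest.eq_zero {U : Set ℝ} {η : ℝ → ℝ} (h : IsTest U η) {x : ℝ} (hx : x ∉ U) : η x = 0 :=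
  image_eq_zero_of_notMem_tsupport fun h' => hx (h.supp h')

theorem IsTest.hasDerivAt {U : Set ℝ} {η : ℝ → ℝ} (h : IsTest U η) (x : ℝ) :
    HasDerivAt η (deriv η x) x :=
  (h.smooth.differentiable (by simp)).differentiableAt.hasDerivAt

theorem IsTest.deriv {U : Set ℝ} {η : ℝ → ℝ} (h : IsTest U η) : IsTest U (deriv η) :=
  ⟨(contDiff_infty_iff_deriv.1 h.smooth).2, h.compact.deriv,
    (closure_minimal support_deriv_subset (isClosed_tsupport η)).trans h.supp⟩

theorem IsTest.smul_integrable {U : Set ℝ} {η : ℝ → ℝ} (h : IsTest U η) {μ : Measure ℝ}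
    {φ : ℝ → E} (hφ : Integrable φ μ) : Integrable (fun t => η t • φ t) μ := by
  obtain ⟨C, hC⟩ := h.compact.exists_bound_of_continuous h.smooth.continuous
  exact hφ.bdd_smul C h.smooth.continuous.aestronglyMeasurable (Filter.Eventually.of_forall hC)

/-- Functions with an absolutely continuous representative are weakly differentiable. -/
theorem isWeakDeriv_of_absolutelyContinuous [CompleteSpace E] {T : ℝ} (hT : 0 < T)
    {f k : ℝ → E} (hf : AbsolutelyContinuousOnInterval f 0 T)
    (hk : IntervalIntegrable k volume 0 T)
    (h : ∀ᵐ x, x ∈ uIcc 0 T → HasDerivAt f (k x) x) : IsWeakDeriv T f k := by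
  intro η hη
  have hηac : AbsolutelyContinuousOnInterval η 0 T :=
    (hη.smooth.of_le (by simp)).contDiffOn.absolutelyContinuousOnInterval
  have hfi : IntervalIntegrable f volume 0 T := hf.continuousOn.intervalIntegrable
  have h1 : IntervalIntegrable (fun t => η t • k t) volume 0 T := by
    rw [intervalIntegrable_iff] at hk ⊢
    exact hη.smul_integrable hk
  have h2 : IntervalIntegrable (fun t => deriv η t • f t) volume 0 T := by
    rw [intervalIntegrable_iff] at hfi ⊢
    exact hη.deriv.smul_integrable hfi
  -- Integration by parts: the boundary terms of η • f vanish because η is supported inside the open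
  -- interval.
  have := integral_eq_sub_of_absolutelyContinuous (hηac.fun_smul hf) (h1.add h2) (by
    filter_upwards [h] with x hx hxT
    exact (hη.hasDerivAt x).smul (hx hxT))
  rw [intervalIntegral.integral_add h1 h2, hη.eq_zero (x := T) (by simp),
    hη.eq_zero (x := 0) (by simp)] at this
  rw [integral_Ioo_eq_interval hT, integral_Ioo_eq_interval hT]
  simp only [zero_smul, sub_zero] at this
  exact (neg_eq_of_add_eq_zero_right this).symm

theorem IsWeakDeriv.sub {T : ℝ} {φ₁ φ₂ w₁ w₂ : ℝ → E}
    (h₁ : IsWeakDeriv T φ₁ w₁) (h₂ : IsWeakDeriv T φ₂ w₂)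
    (hφ₁ : Integrable φ₁ (volume.restrict (Ioo 0 T)))
    (hφ₂ : Integrable φ₂ (volume.restrict (Ioo 0 T)))
    (hw₁ : Integrable w₁ (volume.restrict (Ioo 0 T)))
    (hw₂ : Integrable w₂ (volume.restrict (Ioo 0 T))) :
    IsWeakDeriv T (fun t => φ₁ t - φ₂ t) (fun t => w₁ t - w₂ t) := by
  intro η hη
  simp only [smul_sub]
  rw [integral_sub (hη.deriv.smul_integrable hφ₁) (hη.deriv.smul_integrable hφ₂),
    integral_sub (hη.smul_integrable hw₁) (hη.smul_integrable hw₂), h₁ η hη, h₂ η hη]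
  abel

theorem IsWeakDeriv.clm [CompleteSpace E] [CompleteSpace F] {T : ℝ} {φ w : ℝ → E}
    (h : IsWeakDeriv T φ w) (L : E →L[ℝ] F)
    (hφ : Integrable φ (volume.restrict (Ioo 0 T)))
    (hw : Integrable w (volume.restrict (Ioo 0 T))) :
    IsWeakDeriv T (fun t => L (φ t)) (fun t => L (w t)) := by
  intro η hη
  have h1 := L.integral_comp_comm (hη.deriv.smul_integrable hφ)
  have h2 := L.integral_comp_comm (hη.smul_integrable hw)
  simp only [map_smul] at h1 h2
  rw [h1, h2, h η hη, map_neg]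

theorem IsWeakDeriv.congr {T : ℝ} {φ₁ φ₂ w₁ w₂ : ℝ → E} (h : IsWeakDeriv T φ₁ w₁)
    (hφ : φ₁ =ᵐ[volume.restrict (Ioo 0 T)] φ₂) (hw : w₁ =ᵐ[volume.restrict (Ioo 0 T)] w₂) :
    IsWeakDeriv T φ₂ w₂ := by
  intro η hη
  have h1 : ∫ t in Ioo 0 T, deriv η t • φ₂ t = ∫ t in Ioo 0 T, deriv η t • φ₁ t :=
    integral_congr_ae (by filter_upwards [hφ] with t ht; rw [ht])
  have h2 : ∫ t in Ioo 0 T, η t • w₂ t = ∫ t in Ioo 0 T, η t • w₁ t :=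
    integral_congr_ae (by filter_upwards [hw] with t ht; rw [ht])
  rw [h1, h2, h η hη]

/-- The fundamental lemma of the calculus of variations on `(0,T)`. -/
theorem ae_eq_zero_of_forall_isTest [CompleteSpace E] {T : ℝ} {D : ℝ → E}
    (hD : Integrable D (volume.restrict (Ioo 0 T)))
    (h : ∀ η : ℝ → ℝ, IsTest (Ioo 0 T) η → ∫ t in Ioo 0 T, η t • D t = 0) :
    D =ᵐ[volume.restrict (Ioo 0 T)] 0 := by
  have hD' : LocallyIntegrableOn D (Ioo 0 T) := IntegrableOn.locallyIntegrableOn hD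
  refine (ae_restrict_iff' measurableSet_Ioo).2
    (isOpen_Ioo.ae_eq_zero_of_integral_contDiff_smul_eq_zero hD' fun g hg hgc hgs => ?_)
  rw [← h g ⟨hg, hgc, hgs⟩, setIntegral_eq_integral_of_forall_compl_eq_zero]
  intro x hx
  rw [IsTest.eq_zero ⟨hg, hgc, hgs⟩ hx, zero_smul]

theorem IsWeakDeriv.ae_unique [CompleteSpace E] {T : ℝ} {φ w₁ w₂ : ℝ → E}
    (h₁ : IsWeakDeriv T φ w₁) (h₂ : IsWeakDeriv T φ w₂)
    (hw₁ : Integrable w₁ (volume.restrict (Ioo 0 T)))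
    (hw₂ : Integrable w₂ (volume.restrict (Ioo 0 T))) :
    w₁ =ᵐ[volume.restrict (Ioo 0 T)] w₂ := by
  have := ae_eq_zero_of_forall_isTest (hw₁.sub hw₂) fun η hη => by
    simp only [Pi.sub_apply, smul_sub]
    rw [integral_sub (hη.smul_integrable hw₁) (hη.smul_integrable hw₂), sub_eq_zero,
      ← neg_inj, ← h₁ η hη, ← h₂ η hη]
  filter_upwards [this] with t ht
  simpa [sub_eq_zero] using ht

/-- A test function on `(0,T)` with zero mean is the derivative of a test function. -/
theorem IsTest.exists_primitive {T : ℝ} (hT : 0 < T) {ψ : ℝ → ℝ} (hψ : IsTest (Ioo 0 T) ψ)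
    (h0 : ∫ t in Ioo 0 T, ψ t = 0) : ∃ η, IsTest (Ioo 0 T) η ∧ _root_.deriv η = ψ := by
  have hcont := hψ.smooth.continuous
  have hd : ∀ x, HasDerivAt (fun x => ∫ t in (0 : ℝ)..x, ψ t) (ψ x) x := fun x =>
    intervalIntegral.integral_hasDerivAt_right (hcont.intervalIntegrable _ _)
      (hcont.stronglyMeasurableAtFilter _ _) hcont.continuousAt
  have hderiv : _root_.deriv (fun x => ∫ t in (0 : ℝ)..x, ψ t) = ψ := funext fun x => (hd x).deriv
  have hsub : ∃ a b, 0 < a ∧ b < T ∧ tsupport ψ ⊆ Icc a b := by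
    rcases (tsupport ψ).eq_empty_or_nonempty with he | hne
    -- For ψ = 0 the choice a = T, b = 0 makes `Icc a b` empty and still meets both strict
    -- inequalities.
    · exact ⟨T, 0, hT, hT, by simp [he]⟩
    · have hc : IsCompact (tsupport ψ) := hψ.compact
      exact ⟨sInf (tsupport ψ), sSup (tsupport ψ), (hψ.supp (hc.sInf_mem hne)).1,
        (hψ.supp (hc.sSup_mem hne)).2, fun x hx =>
          ⟨csInf_le hc.bddBelow hx, le_csSup hc.bddAbove hx⟩⟩
  obtain ⟨a, b, ha, hb, hab⟩ := hsub
  have hzero : ∀ x, x ∉ Icc a b → ψ x = 0 := fun x hx =>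
    image_eq_zero_of_notMem_tsupport fun h => hx (hab h)
  have hlt : ∀ x < a, ∫ t in (0 : ℝ)..x, ψ t = 0 := fun x hx => by
    rw [intervalIntegral.integral_congr (g := fun _ => (0 : ℝ)), intervalIntegral.integral_zero]
    intro t ht
    refine hzero t fun h => ?_
    have := ht.2
    have := h.1
    rcases max_cases 0 x with h | h <;> linarith
  have hgt : ∀ x, b < x → ∫ t in (0 : ℝ)..x, ψ t = 0 := fun x hx => by
    rw [← intervalIntegral.integral_add_adjacent_intervals (hcont.intervalIntegrable 0 T)
      (hcont.intervalIntegrable T x), ← integral_Ioo_eq_interval hT, h0, zero_add,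
      intervalIntegral.integral_congr (g := fun _ => (0 : ℝ)), intervalIntegral.integral_zero]
    intro t ht
    refine hzero t fun h => ?_
    have := ht.1
    have := h.2
    rcases min_cases T x with h | h <;> linarith
  have hsupp : tsupport (fun x => ∫ t in (0 : ℝ)..x, ψ t) ⊆ Icc a b := by
    refine closure_minimal (fun x hx => ?_) isClosed_Icc
    by_contra h
    rw [mem_Icc, not_and_or, not_le, not_le] at h
    exact hx (h.elim (hlt x) (hgt x))
  refine ⟨_, ⟨?_, ?_, ?_⟩, hderiv⟩
  · rw [contDiff_infty_iff_deriv, hderiv]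
    exact ⟨fun x => (hd x).differentiableAt, hψ.smooth⟩
  · exact isCompact_Icc.of_isClosed_subset (isClosed_tsupport _) hsupp
  · exact hsupp.trans fun x hx => ⟨ha.trans_le hx.1, hx.2.trans_lt hb⟩

theorem exists_isTest_integral_eq_one {T : ℝ} (hT : 0 < T) :
    ∃ η, IsTest (Ioo 0 T) η ∧ ∫ t in Ioo 0 T, η t = 1 := by
  obtain ⟨g, hgs, hgc, hg, hr, h1⟩ := exists_contDiff_tsupport_subset (n := ⊤)
    (isOpen_Ioo.mem_nhds (show T / 2 ∈ Ioo 0 T from ⟨by linarith, by linarith⟩))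
  have hg' : IsTest (Ioo 0 T) g := ⟨hg, hgc, hgs⟩
  have hpos : 0 < ∫ t in Ioo 0 T, g t := by
    rw [setIntegral_eq_integral_of_forall_compl_eq_zero fun x hx => hg'.eq_zero hx]
    exact hg.continuous.integral_pos_of_hasCompactSupport_nonneg_nonzero hgc
      (fun x => (hr (mem_range_self x)).1) (x := T / 2) (by simp [h1])
  refine ⟨fun t => (∫ t in Ioo 0 T, g t)⁻¹ * g t, ⟨contDiff_const.mul hg, hgc.mul_left,
    (closure_mono (Function.support_mul_subset_right _ _)).trans hgs⟩, ?_⟩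
  rw [integral_const_mul, inv_mul_cancel₀ hpos.ne']

/-- The du Bois-Reymond lemma. -/
theorem ae_eq_const_of_isWeakDeriv_zero [CompleteSpace E] {T : ℝ} (hT : 0 < T) {D : ℝ → E}
    (hD : Integrable D (volume.restrict (Ioo 0 T)))
    (h : IsWeakDeriv T D 0) : ∃ a : E, D =ᵐ[volume.restrict (Ioo 0 T)] fun _ => a := by
  obtain ⟨η₀, hη₀, h1⟩ := exists_isTest_integral_eq_one hT
  refine ⟨∫ t in Ioo 0 T, η₀ t • D t, ?_⟩
  set a := ∫ t in Ioo 0 T, η₀ t • D t with ha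
  have hc : Integrable (fun _ : ℝ => a) (volume.restrict (Ioo 0 T)) := integrable_const a
  have key := ae_eq_zero_of_forall_isTest (hD.sub hc) fun ψ hψ => by
    set m := ∫ t in Ioo 0 T, ψ t with hm
    have hi : ∀ {η}, IsTest (Ioo 0 T) η → Integrable η (volume.restrict (Ioo 0 T)) := fun hη =>
      (hη.smooth.continuous.integrable_of_hasCompactSupport hη.compact).restrict
    -- Removing the mean of ψ by a multiple of η₀ leaves the derivative of a test function, which D
    -- annihilates.
    have hψ' : IsTest (Ioo 0 T) (fun t => ψ t - m * η₀ t) :=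
      ⟨hψ.smooth.sub (contDiff_const.mul hη₀.smooth), hψ.compact.sub hη₀.compact.mul_left,
        (tsupport_sub _ _).trans (union_subset hψ.supp
          ((closure_mono (Function.support_mul_subset_right _ _)).trans hη₀.supp))⟩
    have h0 : ∫ t in Ioo 0 T, (ψ t - m * η₀ t) = 0 := by
      rw [integral_sub (hi hψ) ((hi hη₀).const_mul m), integral_const_mul, h1, ← hm]
      ring
    obtain ⟨η, hη, hηd⟩ := hψ'.exists_primitive hT h0
    have h2 := h η hη
    simp only [hηd, sub_smul, mul_smul, Pi.zero_apply, smul_zero, integral_zero, neg_zero] at h2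
    rw [integral_sub (hψ.smul_integrable hD) ((hη₀.smul_integrable hD).fun_smul m),
      integral_smul, ← ha] at h2
    simp only [Pi.sub_apply, smul_sub]
    rw [integral_sub (hψ.smul_integrable hD) (hψ.smul_integrable hc), integral_smul_const, ← hm, h2]
  filter_upwards [key] with t ht
  simpa [sub_eq_zero] using ht

/-- Subtracting the primitive of w from φ leaves weak derivative zero, so the difference is constant
by du Bois-Reymond. -/
theorem IsWeakDeriv.exists_primitive [CompleteSpace E] {T : ℝ} (hT : 0 < T) {φ w : ℝ → E}
    (h : IsWeakDeriv T φ w) (hφ : Integrable φ (volume.restrict (Ioo 0 T)))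
    (hw : IntervalIntegrable w volume 0 T) :
    ∃ a : E, φ =ᵐ[volume.restrict (Ioo 0 T)] fun t => a + ∫ s in (0 : ℝ)..t, w s := by
  have hac := hw.absolutelyContinuousOnInterval_primitive
  have hP := isWeakDeriv_of_absolutelyContinuous hT hac hw (by
    filter_upwards [hw.ae_hasDerivAt_integral] with x hx hxT
    exact hx hxT 0 left_mem_uIcc)
  have hPi : Integrable (fun t => ∫ s in (0 : ℝ)..t, w s) (volume.restrict (Ioo 0 T)) :=
    (intervalIntegrable_iff_integrableOn_Ioo_of_le hT.le).1 hac.continuousOn.intervalIntegrable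
  have hw' := (intervalIntegrable_iff_integrableOn_Ioo_of_le hT.le).1 hw
  obtain ⟨a, ha⟩ := ae_eq_const_of_isWeakDeriv_zero hT (hφ.sub hPi)
    ((h.sub hP hφ hPi hw' hw').congr Filter.EventuallyEq.rfl (by simp; rfl))
  refine ⟨a, ?_⟩
  filter_upwards [ha] with t ht
  rw [← ht]
  simp

end Calculus

theorem integrable_mul_norm {V : Type*} [NormedAddCommGroup V] {T : ℝ} {φ z : ℝ → V}
    (hz : MemL2 T z) (hφ : MemL2 T φ) :
    Integrable (fun t => ‖z t‖ * ‖φ t‖) (volume.restrict (Ioo 0 T)) :=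
  hz.norm.integrable_mul hφ.norm

/-! ### The energy identity, by resolvent regularisation. -/

section Energy

variable {V H : Type*} [NormedAddCommGroup V] [InnerProductSpace ℝ V] [CompleteSpace V]
  [NormedAddCommGroup H] [InnerProductSpace ℝ H] [CompleteSpace H]

/-- The self-adjoint operator `S = i* i` on `V` attached to `i : V → H`. -/
def gramOp (i : V →L[ℝ] H) : V →L[ℝ] V := (ContinuousLinearMap.adjoint i).comp i

theorem inner_gramOp (i : V →L[ℝ] H) (v w : V) :
    inner ℝ (gramOp i v) w = inner ℝ (i v) (i w) :=
  ContinuousLinearMap.adjoint_inner_left i w (i v)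

theorem isUnit_gramOp_add (i : V →L[ℝ] H) {ε : ℝ} (hε : 0 < ε) :
    IsUnit (gramOp i + ε • (1 : V →L[ℝ] V)) := by
  refine ContinuousLinearMap.isUnit_of_forall_le_norm_inner_map _
    (c := ε.toNNReal) (Real.toNNReal_pos.2 hε) fun x => ?_
  have h : inner ℝ ((gramOp i + ε • (1 : V →L[ℝ] V)) x) x = ‖i x‖ ^ 2 + ε * ‖x‖ ^ 2 := by
    simp [inner_add_left, inner_gramOp, inner_smul_left]
  rw [h, Real.norm_of_nonneg (by positivity), Real.coe_toNNReal _ hε.le]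
  nlinarith [sq_nonneg ‖i x‖]

/-- The resolvent `(S + ε)⁻¹` of `S = i* i`. -/
def resolventOp (i : V →L[ℝ] H) (ε : ℝ) : V →L[ℝ] V := Ring.inverse (gramOp i + ε • 1)

variable (i : V →L[ℝ] H) {ε : ℝ}

theorem gramOp_resolventOp (hε : 0 < ε) (v : V) :
    gramOp i (resolventOp i ε v) + ε • resolventOp i ε v = v := by
  have := congrArg (fun L : V →L[ℝ] V => L v)
    (Ring.mul_inverse_cancel _ (isUnit_gramOp_add i hε))
  simpa [resolventOp] using! this

theorem resolventOp_gramOp (hε : 0 < ε) (v : V) :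
    resolventOp i ε (gramOp i v) + ε • resolventOp i ε v = v := by
  have := congrArg (fun L : V →L[ℝ] V => L v)
    (Ring.inverse_mul_cancel _ (isUnit_gramOp_add i hε))
  simpa [resolventOp] using! this

/-- Pair (S + ε)x = v with x and drop the term ‖i x‖². -/
theorem norm_smul_resolventOp_le (hε : 0 < ε) (v : V) : ‖ε • resolventOp i ε v‖ ≤ ‖v‖ := by
  set x := resolventOp i ε v with hx
  have h : inner ℝ v x = ‖i x‖ ^ 2 + ε * ‖x‖ ^ 2 := by
    conv_lhs => rw [← gramOp_resolventOp i hε v]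
    simp [← hx, inner_add_left, inner_gramOp, inner_smul_left]
  have h2 : inner ℝ v x ≤ ‖v‖ * ‖x‖ := real_inner_le_norm v x
  rw [norm_smul, Real.norm_of_nonneg hε.le]
  rcases (norm_nonneg x).eq_or_lt with h0 | h0
  · rw [← h0, mul_zero]; exact norm_nonneg v
  · have : ε * ‖x‖ * ‖x‖ ≤ ‖v‖ * ‖x‖ := by nlinarith [sq_nonneg ‖i x‖]
    exact le_of_mul_le_mul_right this h0

/-- The regularisation `K_n = (S + 1/(n+1))⁻¹ S`. -/
def regOp (n : ℕ) : V →L[ℝ] V := (resolventOp i (1 / (n + 1))).comp (gramOp i)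

theorem regOp_apply (n : ℕ) (v : V) :
    regOp i n v = v - (1 / (n + 1) : ℝ) • resolventOp i (1 / (n + 1)) v :=
  eq_sub_of_add_eq (resolventOp_gramOp i (by positivity) v)

theorem gramOp_resolventOp_eq_regOp (n : ℕ) (v : V) :
    gramOp i (resolventOp i (1 / (n + 1)) v) = regOp i n v := by
  rw [regOp_apply, ← eq_sub_of_add_eq (gramOp_resolventOp i (by positivity) v)]

theorem norm_regOp_sub_le (n : ℕ) (v : V) : ‖regOp i n v - v‖ ≤ ‖v‖ := by
  rw [regOp_apply, sub_sub_cancel_left, norm_neg]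
  exact norm_smul_resolventOp_le i (by positivity) v

theorem norm_regOp_le (n : ℕ) (v : V) : ‖regOp i n v‖ ≤ 2 * ‖v‖ := by
  have := norm_add_le (regOp i n v - v) v
  rw [sub_add_cancel] at this
  linarith [norm_regOp_sub_le i n v]

variable {i}

/-- A vector x orthogonal to the range satisfies 0 = ⟨Sx, x⟩ = ‖i x‖². -/
theorem dense_range_gramOp (hi : Function.Injective i) : DenseRange (gramOp i) := by
  have h : (LinearMap.range (gramOp i).toLinearMap)ᗮ = ⊥ := by
    rw [Submodule.eq_bot_iff]
    intro x hx
    have h1 := (Submodule.mem_orthogonal _ x).1 hx (gramOp i x) ⟨x, rfl⟩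
    rw [inner_gramOp, real_inner_self_eq_norm_sq] at h1
    exact hi (by simpa using h1)
  have h2 := (Submodule.topologicalClosure_eq_top_iff).2 h
  rw [← Submodule.dense_iff_topologicalClosure_eq_top] at h2
  exact h2

/-- On the range of S the error is ε K_n w in norm, of size at most 2ε‖w‖; density and the uniform
bound on K_n - 1 give the rest. -/
theorem tendsto_regOp (hi : Function.Injective i) (v : V) :
    Tendsto (fun n => regOp i n v) atTop (𝓝 v) := by
  rw [Metric.tendsto_atTop]
  intro δ hδ
  obtain ⟨w, hw⟩ := (dense_range_gramOp hi).exists_dist_lt v (half_pos hδ)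
  obtain ⟨N, hN⟩ := exists_nat_gt (2 * ‖w‖ / (δ / 2))
  refine ⟨N, fun n hn => ?_⟩
  have hn' : 2 * ‖w‖ / (δ / 2) < n + 1 := hN.trans (by
    have : (N : ℝ) ≤ n := by exact_mod_cast hn
    linarith)
  have h1 : ‖regOp i n (v - gramOp i w) - (v - gramOp i w)‖ < δ / 2 :=
    (norm_regOp_sub_le i n _).trans_lt (by rwa [← dist_eq_norm])
  have h2 : ‖regOp i n (gramOp i w) - gramOp i w‖ < δ / 2 := by
    rw [regOp_apply, sub_sub_cancel_left, norm_neg, norm_smul]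
    have h3 : ‖resolventOp i (1 / (n + 1)) (gramOp i w)‖ ≤ 2 * ‖w‖ := norm_regOp_le i n w
    rw [Real.norm_of_nonneg (by positivity)]
    rw [div_lt_iff₀ (half_pos hδ)] at hn'
    calc _ ≤ 1 / ((n : ℝ) + 1) * (2 * ‖w‖) := by gcongr
      _ < δ / 2 := by
        rw [one_div, inv_mul_lt_iff₀ (by positivity)]
        linarith
  rw [dist_eq_norm]
  have : regOp i n v - v = (regOp i n (v - gramOp i w) - (v - gramOp i w))
      + (regOp i n (gramOp i w) - gramOp i w) := by
    rw [map_sub]; abel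
  rw [this]
  linarith [norm_add_le (regOp i n (v - gramOp i w) - (v - gramOp i w))
    (regOp i n (gramOp i w) - gramOp i w)]

/-- The chain rule for the squared norm, valid because the norm squared of an absolutely continuous
function is absolutely continuous. -/
theorem norm_sq_primitive_sub {h₀ : H} {k : ℝ → H} {T s t : ℝ}
    (hk : IntervalIntegrable k volume 0 T) (hs : s ∈ uIcc 0 T) (ht : t ∈ uIcc 0 T) :
    ‖h₀ + ∫ r in (0 : ℝ)..t, k r‖ ^ 2 - ‖h₀ + ∫ r in (0 : ℝ)..s, k r‖ ^ 2
      = ∫ r in s..t, 2 * inner ℝ (h₀ + ∫ q in (0 : ℝ)..r, k q) (k r) := by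
  have hac : AbsolutelyContinuousOnInterval (fun t => h₀ + ∫ r in (0 : ℝ)..t, k r) 0 T :=
    hk.absolutelyContinuousOnInterval_primitive.of_dist_le fun x _ y _ => by simp
  have hsub := uIcc_subset_uIcc hs ht
  refine (integral_eq_sub_of_absolutelyContinuous (hac.norm_sq.mono hsub) ?_ ?_).symm
  · have h1 : IntervalIntegrable k volume s t := hk.mono_set hsub
    have hc : ContinuousOn (fun t => h₀ + ∫ r in (0 : ℝ)..t, k r) (uIcc s t) :=
      hac.continuousOn.mono hsub
    obtain ⟨C, hC⟩ := isCompact_uIcc.exists_bound_of_continuousOn hc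
    rw [intervalIntegrable_iff] at h1 ⊢
    have hm : AEStronglyMeasurable (fun t => h₀ + ∫ r in (0 : ℝ)..t, k r)
        (volume.restrict (uIoc s t)) :=
      (hc.mono uIoc_subset_uIcc).aestronglyMeasurable measurableSet_uIoc
    refine (h1.norm.const_mul (2 * C)).mono' ((hm.inner h1.1).const_mul 2) ?_
    filter_upwards [ae_restrict_mem measurableSet_uIoc] with r hr
    rw [norm_mul, Real.norm_ofNat, mul_assoc]
    have := hC r (uIoc_subset_uIcc hr)
    have h2 := norm_inner_le_norm (𝕜 := ℝ) (h₀ + ∫ r in (0 : ℝ)..r, k r) (k r)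
    have : ‖inner ℝ (h₀ + ∫ r in (0 : ℝ)..r, k r) (k r)‖ ≤ C * ‖k r‖ := h2.trans (by gcongr)
    linarith
  · filter_upwards [hk.ae_hasDerivAt_integral] with x hx hxT
    exact ((hx (hsub hxT) 0 left_mem_uIcc).const_add h₀).norm_sq

variable {T : ℝ} {φ z : ℝ → V}

theorem tendsto_integral_regOp_sub (hi : Function.Injective i) (hφ : MemL2 T φ)
    (hz : MemL2 T z) :
    Tendsto (fun n => ∫ t in Ioo 0 T, ‖regOp i n (z t) - z t‖ * ‖φ t‖) atTop (𝓝 0) := by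
  have h := tendsto_integral_of_dominated_convergence
    (μ := volume.restrict (Ioo 0 T))
    (F := fun n t => ‖regOp i n (z t) - z t‖ * ‖φ t‖) (f := fun _ => 0)
    (fun t => ‖z t‖ * ‖φ t‖) (fun n => ?_) (integrable_mul_norm hz hφ) (fun n => ?_) ?_
  · simpa using h
  · exact ((((regOp i n).continuous.comp_aestronglyMeasurable hz.1).sub hz.1).norm).mul hφ.1.norm
  · refine Eventually.of_forall fun t => ?_
    rw [norm_mul, norm_norm, norm_norm]
    gcongr
    exact norm_regOp_sub_le i n _
  · refine Eventually.of_forall fun t => ?_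
    have := ((tendsto_regOp hi (z t)).sub_const (z t)).norm.mul_const ‖φ t‖
    simpa using this

theorem tendsto_integral_inner_regOp (hi : Function.Injective i) (hφ : MemL2 T φ)
    (hz : MemL2 T z) :
    Tendsto (fun n => ∫ t in Ioo 0 T, 2 * inner ℝ (regOp i n (φ t)) (regOp i n (z t))) atTop
      (𝓝 (∫ t in Ioo 0 T, 2 * inner ℝ (φ t) (z t))) := by
  refine tendsto_integral_of_dominated_convergence (fun t => 8 * (‖z t‖ * ‖φ t‖)) (fun n => ?_)
    ((integrable_mul_norm hz hφ).const_mul 8) (fun n => ?_) ?_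
  · exact (((regOp i n).continuous.comp_aestronglyMeasurable hφ.1).inner
      ((regOp i n).continuous.comp_aestronglyMeasurable hz.1)).const_mul 2
  · refine Eventually.of_forall fun t => ?_
    have h1 := norm_inner_le_norm (𝕜 := ℝ) (regOp i n (φ t)) (regOp i n (z t))
    have h2 : ‖regOp i n (φ t)‖ * ‖regOp i n (z t)‖ ≤ (2 * ‖φ t‖) * (2 * ‖z t‖) := by
      gcongr <;> exact norm_regOp_le i n _
    rw [norm_mul, Real.norm_ofNat]
    linarith
  · refine Eventually.of_forall fun t => ?_
    exact ((tendsto_regOp hi (φ t)).inner (tendsto_regOp hi (z t))).const_mul 2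

/-- The energy identity for `ψ = a + ∫ z`, regularised by an operator commuting with `S`. -/
theorem norm_sq_clm_primitive_sub (hT : 0 < T) (hz : MemL2 T z) {a : V}
    (ha : (fun t => gramOp i (φ t)) =ᵐ[volume.restrict (Ioo 0 T)]
      fun t => a + ∫ r in (0 : ℝ)..t, z r)
    {L K : V →L[ℝ] V} (hLS : ∀ v, L (gramOp i v) = K v) (hSL : ∀ v, gramOp i (L v) = K v)
    {s t : ℝ} (hs : s ∈ Icc 0 T) (ht : t ∈ Icc 0 T) :
    ‖i (L (a + ∫ r in (0 : ℝ)..t, z r))‖ ^ 2 - ‖i (L (a + ∫ r in (0 : ℝ)..s, z r))‖ ^ 2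
      = ∫ r in s..t, 2 * inner ℝ (K (φ r)) (K (z r)) := by
  have hzi := intervalIntegrable_of_memL2 hT hz
  rw [← uIcc_of_le hT.le] at hs ht
  have hcomm : ∀ r ∈ uIcc 0 T, i (L (a + ∫ q in (0 : ℝ)..r, z q))
      = i (L a) + ∫ q in (0 : ℝ)..r, i (L (z q)) := fun r hr => by
    have := (i.comp L).intervalIntegral_comp_comm
      (hzi.mono_set (uIcc_subset_uIcc left_mem_uIcc hr))
    simp only [ContinuousLinearMap.comp_apply] at this
    rw [this, map_add, map_add]
  have hki : IntervalIntegrable (fun q => i (L (z q))) volume 0 T := by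
    rw [intervalIntegrable_iff] at hzi ⊢
    exact (i.comp L).integrable_comp hzi
  rw [hcomm t ht, hcomm s hs, norm_sq_primitive_sub hki hs ht]
  have ha' : ∀ᵐ r, r ∈ Ioc 0 T → gramOp i (φ r) = a + ∫ q in (0 : ℝ)..r, z q := by
    rw [restrict_Ioo_eq_restrict_Ioc] at ha
    exact (ae_restrict_iff' measurableSet_Ioc).1 ha
  refine intervalIntegral.integral_congr_ae ?_
  filter_upwards [ha'] with r hr hrst
  have hr0 : r ∈ Ioc 0 T := by
    rw [← uIoc_of_le hT.le]
    rw [uIcc_of_le hT.le] at hs ht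
    exact ⟨by simpa [hT.le] using (le_min hs.1 ht.1).trans_lt hrst.1,
      hrst.2.trans (by simpa [hT.le] using ⟨hs.2, ht.2⟩)⟩
  have hrT : r ∈ uIcc 0 T := by rw [uIcc_of_le hT.le]; exact Ioc_subset_Icc_self hr0
  -- With ψ = Sφ: ⟨iLSφ, iLz⟩ = ⟨iKφ, iLz⟩ = ⟨Kφ, SLz⟩ = ⟨Kφ, Kz⟩.
  rw [← hcomm r hrT, ← hr hr0, hLS, real_inner_comm, ← inner_gramOp, hSL,
    real_inner_comm]

/-- **Lions–Magenes**: a function in `L²(0,T;V)` with weak derivative in `L²(0,T;V')` has a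
continuous representative in `H`, which satisfies the energy identity. -/
theorem exists_continuous_rep_energy (hi : Function.Injective i) (hT : 0 < T) (hφ : MemL2 T φ)
    (hz : MemL2 T z) (hw : IsWeakDeriv T (fun t => gramOp i (φ t)) z) :
    ∃ c : ℝ → H, ContinuousOn c (Icc 0 T) ∧
      (∀ᵐ t ∂(volume.restrict (Ioo 0 T)), c t = i (φ t)) ∧
      ‖c T‖ ^ 2 - ‖c 0‖ ^ 2 = ∫ t in Ioo 0 T, 2 * inner ℝ (φ t) (z t) := by
  have hzi := intervalIntegrable_of_memL2 hT hz
  obtain ⟨a, ha⟩ := hw.exists_primitive hT ((gramOp i).integrable_comp (integrable_of_memL2 hφ)) hzi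
  set ψ : ℝ → V := fun t => a + ∫ r in (0 : ℝ)..t, z r with hψ
  have hψc : ContinuousOn ψ (Icc 0 T) := by
    have := hzi.absolutelyContinuousOnInterval_primitive.continuousOn
    rw [uIcc_of_le hT.le] at this
    exact continuousOn_const.add this
  let J : ℕ → V →L[ℝ] V := fun n => resolventOp i (1 / (n + 1))
  let cn : ℕ → ℝ → H := fun n t => i (J n (ψ t))
  have hJS : ∀ n v, J n (gramOp i v) = regOp i n v := fun n v => rfl
  have hSJ : ∀ n v, gramOp i (J n v) = regOp i n v := gramOp_resolventOp_eq_regOp i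
  have hne : (ae (volume.restrict (Ioo 0 T))).NeBot := by
    rw [ae_neBot, Ne, Measure.restrict_eq_zero, Real.volume_Ioo]
    simpa using hT
  -- An anchor time where Sφ(s) = ψ(s): there `cn n s` is i K_n φ(s), which converges. The energy
  -- identity carries the Cauchy property from s to all of [0, T].
  obtain ⟨s, hsψ, hsT⟩ := (ha.and (ae_restrict_mem measurableSet_Ioo)).exists
  have hs : s ∈ Icc 0 T := Ioo_subset_Icc_self hsT
  have hlim : ∀ t, gramOp i (φ t) = ψ t → Tendsto (fun n => cn n t) atTop (𝓝 (i (φ t))) := by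
    intro t ht
    have : ∀ n, cn n t = i (regOp i n (φ t)) := fun n => by simp only [cn, ← ht, hJS]
    simp only [this]
    exact (i.continuous.tendsto _).comp (tendsto_regOp hi _)
  set b : ℕ → ℝ := fun n => ∫ t in Ioo 0 T, ‖regOp i n (z t) - z t‖ * ‖φ t‖ with hb
  have hb0 : Tendsto b atTop (𝓝 0) := tendsto_integral_regOp_sub hi hφ hz
  have hbi : ∀ n, Integrable (fun t => ‖regOp i n (z t) - z t‖ * ‖φ t‖)
      (volume.restrict (Ioo 0 T)) := fun n =>
    integrable_mul_norm (z := fun t => regOp i n (z t) - z t)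
      (((regOp i n).comp_memLp' hz).sub hz) hφ
  -- The energy identity for J_n - J_m. The 8 is the factor 2 times the bound 4‖φ‖ for (K_n - K_m)φ,
  -- while (K_n - K_m)z is split through z.
  have hdiff : ∀ n m, ∀ t ∈ Icc 0 T,
      ‖cn n t - cn m t‖ ^ 2 ≤ ‖cn n s - cn m s‖ ^ 2 + 8 * (b n + b m) := by
    intro n m t ht
    have h1 := norm_sq_clm_primitive_sub hT hz ha (L := J n - J m) (K := regOp i n - regOp i m)
      (fun v => by simp [hJS]) (fun v => by simp [hSJ]) hs ht
    have h2 : ∀ r, i ((J n - J m) (a + ∫ q in (0 : ℝ)..r, z q)) = cn n r - cn m r := fun r => by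
      simp only [sub_apply, map_sub]; rfl
    rw [h2, h2] at h1
    have h3 : ‖∫ r in s..t, 2 * inner ℝ ((regOp i n - regOp i m) (φ r))
        ((regOp i n - regOp i m) (z r))‖ ≤ 8 * (b n + b m) := by
      rw [intervalIntegral.norm_integral_eq_norm_integral_uIoc]
      have hsub : uIoc s t ⊆ Ioc 0 T := fun r hr =>
        ⟨(le_min hs.1 ht.1).trans_lt hr.1, hr.2.trans (max_le hs.2 ht.2)⟩
      have hbi' := fun n => (hbi n).const_mul 8
      have e1 : 8 * (b n + b m) = ∫ r in Ioc 0 T, (8 * (‖regOp i n (z r) - z r‖ * ‖φ r‖)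
          + 8 * (‖regOp i m (z r) - z r‖ * ‖φ r‖)) := by
        rw [integral_Ioc_eq_integral_Ioo, integral_add (hbi' n) (hbi' m), integral_const_mul,
          integral_const_mul, mul_add]
      have hint := (hbi' n).add (hbi' m)
      rw [restrict_Ioo_eq_restrict_Ioc] at hint
      rw [e1]
      refine (norm_integral_le_of_norm_le (hint.mono_measure (Measure.restrict_mono_set _ hsub))
        (Eventually.of_forall fun r => ?_)).trans (setIntegral_mono_set hint
          (Eventually.of_forall fun r => by simp only [Pi.add_apply, Pi.zero_apply]; positivity)
          hsub.eventuallyLE)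
      have i1 := norm_inner_le_norm (𝕜 := ℝ) ((regOp i n - regOp i m) (φ r))
        ((regOp i n - regOp i m) (z r))
      have i2 : ‖(regOp i n - regOp i m) (φ r)‖ ≤ 4 * ‖φ r‖ := by
        rw [sub_apply]
        refine (norm_sub_le _ _).trans ?_
        linarith [norm_regOp_le i n (φ r), norm_regOp_le i m (φ r)]
      have i3 : ‖(regOp i n - regOp i m) (z r)‖
          ≤ ‖regOp i n (z r) - z r‖ + ‖regOp i m (z r) - z r‖ := by
        have : (regOp i n - regOp i m) (z r) = (regOp i n (z r) - z r) - (regOp i m (z r) - z r) := by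
          simp
        rw [this]
        exact norm_sub_le _ _
      have i4 : ‖(regOp i n - regOp i m) (φ r)‖ * ‖(regOp i n - regOp i m) (z r)‖
        ≤ (4 * ‖φ r‖) * (‖regOp i n (z r) - z r‖ + ‖regOp i m (z r) - z r‖) := by gcongr
      rw [norm_mul, Real.norm_ofNat]
      simp only [Pi.add_apply]
      linarith
    have h4 := (le_abs_self _).trans h3
    linarith
  have hucs : UniformCauchySeqOn cn atTop (Icc 0 T) := by
    rw [Metric.uniformCauchySeqOn_iff]
    intro δ hδ
    have hcs : CauchySeq fun n => cn n s := (hlim s hsψ).cauchySeq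
    obtain ⟨N₁, hN₁⟩ := Metric.cauchySeq_iff.1 hcs (δ / 2) (half_pos hδ)
    -- The bound becomes δ²/4 + 8 · 2 · δ²/32 = 3δ²/4 < δ².
    obtain ⟨N₂, hN₂⟩ := Metric.tendsto_atTop.1 hb0 (δ ^ 2 / 32) (by positivity)
    refine ⟨max N₁ N₂, fun m hm n hn t ht => ?_⟩
    have h1 := hN₁ m (le_of_max_le_left hm) n (le_of_max_le_left hn)
    have h2 := hN₂ m (le_of_max_le_right hm)
    have h3 := hN₂ n (le_of_max_le_right hn)
    rw [Real.dist_eq, sub_zero] at h2 h3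
    rw [dist_eq_norm] at h1 ⊢
    have h4 := hdiff m n t ht
    have h5 : ‖cn m s - cn n s‖ ^ 2 < (δ / 2) ^ 2 := by gcongr
    refine lt_of_pow_lt_pow_left₀ 2 hδ.le ?_
    have := (abs_lt.1 h2).2
    have := (abs_lt.1 h3).2
    nlinarith
  have hex : ∀ t, ∃ y, t ∈ Icc 0 T → Tendsto (fun n => cn n t) atTop (𝓝 y) := fun t => by
    by_cases ht : t ∈ Icc 0 T
    · obtain ⟨y, hy⟩ := cauchySeq_tendsto_of_complete (hucs.cauchySeq ht)
      exact ⟨y, fun _ => hy⟩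
    · exact ⟨0, fun h => absurd h ht⟩
  choose c hc using hex
  have hunif := hucs.tendstoUniformlyOn_of_tendsto hc
  refine ⟨c, hunif.continuousOn (Frequently.of_forall fun n =>
    i.continuous.comp_continuousOn ((J n).continuous.comp_continuousOn hψc)), ?_, ?_⟩
  · filter_upwards [ha, ae_restrict_mem measurableSet_Ioo] with t ht htT
    exact tendsto_nhds_unique (hc t (Ioo_subset_Icc_self htT)) (hlim t ht)
  · have h0 : (0 : ℝ) ∈ Icc 0 T := left_mem_Icc.2 hT.le
    have h1 : T ∈ Icc 0 T := right_mem_Icc.2 hT.le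
    refine tendsto_nhds_unique (((hc T h1).norm.pow 2).sub ((hc 0 h0).norm.pow 2)) ?_
    have h2 : ∀ n, ‖cn n T‖ ^ 2 - ‖cn n 0‖ ^ 2
        = ∫ t in Ioo 0 T, 2 * inner ℝ (regOp i n (φ t)) (regOp i n (z t)) := fun n => by
      rw [integral_Ioo_eq_interval hT]
      exact norm_sq_clm_primitive_sub hT hz ha (hJS n) (hSJ n) h0 h1
    simp only [h2]
    exact tendsto_integral_inner_regOp hi hφ hz

end Energy

/-! ### The Riesz map of the form (g v, g w) and the associated dual norm. -/

section GradientRiesz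

variable {V K : Type*} [NormedAddCommGroup V] [InnerProductSpace ℝ V] [CompleteSpace V]
  [NormedAddCommGroup K] [InnerProductSpace ℝ K] [CompleteSpace K]

variable (V) in
/-- The Riesz isomorphism as a real-linear map. -/
def rieszL : StrongDual ℝ V →L[ℝ] V :=
  LinearMap.mkContinuous
    { toFun := (InnerProductSpace.toDual ℝ V).symm
      map_add' := map_add _
      map_smul' := fun c Φ => by simp } 1 fun Φ => by simp

theorem inner_rieszL (Φ : StrongDual ℝ V) (v : V) : inner ℝ (rieszL V Φ) v = Φ v :=
  InnerProductSpace.toDual_symm_apply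

/-- The Riesz map with respect to the inner product `(g v, g w)`. -/
def formRiesz (g : V →L[ℝ] K) : StrongDual ℝ V →L[ℝ] V :=
  (Ring.inverse (gramOp g)).comp (rieszL V)

variable {g : V →L[ℝ] K} {c : ℝ}

/-- Lax–Milgram: coercivity makes g*g invertible, so its inverse in `formRiesz` is a genuine one. -/
theorem inner_formRiesz (hc : 0 < c) (hg : ∀ v, c * ‖v‖ ^ 2 ≤ ‖g v‖ ^ 2)
    (Φ : StrongDual ℝ V) (v : V) : inner ℝ (g (formRiesz g Φ)) (g v) = Φ v := by
  have hu : IsUnit (gramOp g) := by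
    refine ContinuousLinearMap.isUnit_of_forall_le_norm_inner_map _
      (c := c.toNNReal) (Real.toNNReal_pos.2 hc) fun x => ?_
    rw [inner_gramOp, real_inner_self_eq_norm_sq, Real.norm_of_nonneg (by positivity),
      Real.coe_toNNReal _ hc.le, mul_comm]
    exact hg x
  have h := congrArg (fun L : V →L[ℝ] V => L (rieszL V Φ)) (Ring.mul_inverse_cancel _ hu)
  have h' : gramOp g (formRiesz g Φ) = rieszL V Φ := by simpa [formRiesz] using! h
  rw [← inner_gramOp, h', inner_rieszL]

/-- Cauchy–Schwarz bounds every quotient, and a nonzero representative attains the bound. -/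
theorem sSup_dual_eq_norm_formRiesz (hc : 0 < c) (hg : ∀ v, c * ‖v‖ ^ 2 ≤ ‖g v‖ ^ 2)
    (Φ : StrongDual ℝ V) :
    sSup {r : ℝ | ∃ v : V, v ≠ 0 ∧ r = Φ v / ‖g v‖} = ‖g (formRiesz g Φ)‖ := by
  have hle : ∀ r ∈ {r : ℝ | ∃ v : V, v ≠ 0 ∧ r = Φ v / ‖g v‖}, r ≤ ‖g (formRiesz g Φ)‖ := by
    rintro r ⟨v, -, rfl⟩
    rw [← inner_formRiesz hc hg Φ v]
    exact div_le_of_le_mul₀ (norm_nonneg _) (norm_nonneg _) (real_inner_le_norm _ _)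
  refine le_antisymm (Real.sSup_le hle (norm_nonneg _)) ?_
  by_cases h0 : formRiesz g Φ = 0
  · rw [h0, map_zero, norm_zero]
    -- This also covers the trivial space, where the set is empty and `sSup` is 0.
    refine Real.sSup_nonneg ?_
    rintro r ⟨v, -, rfl⟩
    rw [← inner_formRiesz hc hg Φ v, h0]
    simp
  · refine le_csSup ⟨_, hle⟩ ⟨_, h0, ?_⟩
    rw [← inner_formRiesz hc hg Φ, real_inner_self_eq_norm_sq, sq, mul_self_div_self]

/-- Equality of functionals against every fixed vector for a.e. parameter gives a.e. equality of
the Riesz representatives. -/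
theorem formRiesz_ae_eq_zero (hc : 0 < c) (hg : ∀ v, c * ‖v‖ ^ 2 ≤ ‖g v‖ ^ 2)
    {μ : Measure ℝ} {G : ℝ → StrongDual ℝ V} (hG : AEStronglyMeasurable G μ)
    (h : ∀ v, ∀ᵐ t ∂μ, G t v = 0) : ∀ᵐ t ∂μ, formRiesz g (G t) = 0 := by
  have hm : AEStronglyMeasurable (fun t => formRiesz g (G t)) μ :=
    (formRiesz g).continuous.comp_aestronglyMeasurable hG
  -- The null set in `h` depends on v; almost separable range reduces the claim to testing against
  -- each fixed functional.
  obtain ⟨t, hts, ht⟩ := hm.isSeparable_ae_range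
  refine ae_eq_zero_of_forall_dual_of_isSeparable ℝ hts (fun Φ => ?_) ht
  -- By symmetry of the form, Φ applied to the representative of G(s) equals G(s) applied to that of
  -- Φ.
  filter_upwards [h (formRiesz g Φ)] with s hs
  simp only [Pi.zero_apply]
  rw [← inner_formRiesz hc hg Φ, real_inner_comm, inner_formRiesz hc hg, hs]

end GradientRiesz

/-! ### Completeness of H¹₀, injectivity of its inclusion into L², and Poincaré's inequality. -/

section Sobolev

variable {d : ℕ} {Ω : Set (Sp d)}

theorem integral_norm_mul_norm_le {α E F : Type*} [MeasurableSpace α] {μ : Measure α}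
    [NormedAddCommGroup E] [NormedAddCommGroup F] (f : Lp E 2 μ) (g : Lp F 2 μ) :
    ∫ x, ‖f x‖ * ‖g x‖ ∂μ ≤ ‖f‖ * ‖g‖ := by
  have h := real_inner_le_norm ((Lp.memLp f).norm.toLp) ((Lp.memLp g).norm.toLp)
  rw [L2.inner_def, Lp.norm_toLp, Lp.norm_toLp, eLpNorm_norm, eLpNorm_norm] at h
  refine le_trans (le_of_eq (integral_congr_ae ?_)) h
  filter_upwards [(Lp.memLp f).norm.coeFn_toLp, (Lp.memLp g).norm.coeFn_toLp] with x h1 h2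
  rw [h1, h2]
  simp [mul_comm]

theorem continuous_integral_L2_mul {ψ : Sp d → ℝ} (hψ : MemLp ψ 2 (volume.restrict Ω)) :
    Continuous fun v : L2 Ω => ∫ x in Ω, v x * ψ x := by
  have h : ∀ v : L2 Ω, ∫ x in Ω, v x * ψ x = inner ℝ (hψ.toLp ψ) v := fun v => by
    rw [L2.inner_def]
    refine integral_congr_ae ?_
    filter_upwards [hψ.coeFn_toLp] with x hx
    rw [hx]
    simp
  simp only [h]
  fun_prop

theorem continuous_integral_L2Vec_mul {ψ : Sp d → ℝ} (hψ : MemLp ψ 2 (volume.restrict Ω))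
    (i : Fin d) : Continuous fun g : L2Vec Ω => ∫ x in Ω, g x i * ψ x := by
  let L : L2Vec Ω →L[ℝ] L2 Ω :=
    (EuclideanSpace.proj i : Sp d →L[ℝ] ℝ).compLpL 2 (volume.restrict Ω)
  have h : ∀ g : L2Vec Ω, ∫ x in Ω, g x i * ψ x = ∫ x in Ω, L g x * ψ x := fun g => by
    refine integral_congr_ae ?_
    filter_upwards [(EuclideanSpace.proj i : Sp d →L[ℝ] ℝ).coeFn_compLpL (p := 2) g] with x hx
    rw [hx]
    simp
  simp only [h]
  exact (continuous_integral_L2_mul hψ).comp L.continuous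

theorem isClosed_H1 (Ω : Set (Sp d)) :
    IsClosed (H1 Ω : Set (WithLp 2 (L2 Ω × L2Vec Ω))) := by
  have h : (H1 Ω : Set (WithLp 2 (L2 Ω × L2Vec Ω)))
      = ⋂ (i : Fin d) (φ : Sp d → ℝ) (_ : IsTest Ω φ),
        {p | ∫ x in Ω, p.fst x * partialD φ i x = -∫ x in Ω, p.snd x i * φ x} := by
    ext p
    simp only [mem_iInter]
    rfl
  rw [h]
  refine isClosed_iInter fun i => isClosed_iInter fun φ => isClosed_iInter fun hφ =>
    isClosed_eq ?_ ?_
  · exact (continuous_integral_L2_mul (hφ.memLp_partialD i)).comp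
      (WithLp.fstL 2 ℝ (L2 Ω) (L2Vec Ω)).continuous
  · exact ((continuous_integral_L2Vec_mul hφ.memLp i).comp
      (WithLp.sndL 2 ℝ (L2 Ω) (L2Vec Ω)).continuous).neg

instance completeSpace_H1 : CompleteSpace (H1 Ω) := (isClosed_H1 Ω).completeSpace_coe

instance completeSpace_H10 : CompleteSpace (H10 Ω) :=
  (Submodule.isClosed_topologicalClosure _).completeSpace_coe

theorem norm_sq_H10 (v : H10 Ω) : ‖v‖ ^ 2 = ‖toL2 Ω v‖ ^ 2 + ‖grad Ω v‖ ^ 2 :=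
  WithLp.prod_norm_sq_eq_of_L2 v.1.1

/-- Elements are pairs (v, ∇v), so uniqueness of the weak gradient is what is needed: for v = 0 the
gradient is orthogonal to all test functions. -/
theorem injective_toL2 (hΩ : IsOpen Ω) : Function.Injective (toL2 Ω) := by
  rw [injective_iff_map_eq_zero]
  intro v hv
  have hg : grad Ω v = 0 := by
    have hw : IsWeakGrad Ω (toL2 Ω v) (grad Ω v) := v.1.2
    have hi : ∀ i, ∀ᵐ x ∂(volume.restrict Ω), (grad Ω v) x i = 0 := fun i => by
      have hl : LocallyIntegrableOn (fun x => (grad Ω v) x i) Ω := fun x hx => by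
        obtain ⟨r, hr, hrΩ⟩ := Metric.isOpen_iff.1 hΩ x hx
        refine ⟨Metric.ball x r, mem_nhdsWithin_of_mem_nhds (Metric.ball_mem_nhds x hr), ?_⟩
        have hm := (memLp_coord (grad Ω v) i).mono_measure (Measure.restrict_mono_set _ hrΩ)
        have : IsFiniteMeasure (volume.restrict (Metric.ball x r)) :=
          ⟨by simpa using measure_ball_lt_top⟩
        exact hm.integrable (by norm_num)
      refine (ae_restrict_iff' hΩ.measurableSet).2
        (hΩ.ae_eq_zero_of_integral_contDiff_smul_eq_zero hl fun φ hφ hφc hφs => ?_)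
      have h1 := hw i φ ⟨hφ, hφc, hφs⟩
      rw [hv] at h1
      have h2 : ∫ x in Ω, (0 : L2 Ω) x * partialD φ i x = 0 := by
        refine integral_eq_zero_of_ae ?_
        filter_upwards [Lp.coeFn_zero ℝ 2 (volume.restrict Ω)] with x hx
        rw [hx]
        simp
      rw [h2, eq_comm, neg_eq_zero] at h1
      rw [← h1, setIntegral_eq_integral_of_forall_compl_eq_zero]
      · simp only [smul_eq_mul, mul_comm]
      · intro x hx
        rw [image_eq_zero_of_notMem_tsupport fun h => hx (hφs h), mul_zero]
    refine (Lp.eq_zero_iff_ae_eq_zero).2 ?_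
    filter_upwards [ae_all_iff.2 hi] with x hx
    ext i
    exact hx i
  have := norm_sq_H10 v
  rw [hv, hg] at this
  simpa using this

/-- The Poincaré inequality for test functions on a set on which `|x_i| ≤ R`. -/
theorem norm_le_of_isTest {R : ℝ} (hR0 : 0 ≤ R) (i : Fin d) (hR : ∀ x ∈ Ω, |x i| ≤ R)
    (hΩ : MeasurableSet Ω) {v : L2 Ω} {g : L2Vec Ω} (hw : IsWeakGrad Ω v g) {φ : Sp d → ℝ}
    (hφ : IsTest Ω φ) (hv : v =ᵐ[volume.restrict Ω] φ) : ‖v‖ ≤ 2 * R * ‖g‖ := by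
  -- Testing the weak gradient with x_i φ. Since ∂_i h = φ + x_i ∂_i φ, integration by parts gives
  -- 2∫ φ ∂_i h = ‖v‖²; moreover ∫ φ ∂_i h = -∫ g_i h, which is at most R‖g‖‖v‖ in modulus.
  set h : Sp d → ℝ := fun x => x i * φ x with hh
  have hpr : ContDiff ℝ ∞ fun x : Sp d => x i := (EuclideanSpace.proj i : Sp d →L[ℝ] ℝ).contDiff
  have ht : IsTest Ω h := ⟨hpr.mul hφ.smooth, hφ.compact.mul_left,
    (closure_mono (Function.support_mul_subset_right _ _)).trans hφ.supp⟩
  have hdiff : ∀ {ψ}, IsTest Ω ψ → Differentiable ℝ ψ := fun hψ =>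
    hψ.smooth.differentiable (by simp)
  have hcd : ∀ {ψ}, IsTest Ω ψ → Continuous (partialD ψ i) := fun hψ =>
    (hψ.smooth.continuous_fderiv (by simp)).clm_apply continuous_const
  have hdh : ∀ x, partialD h i x = φ x + x i * partialD φ i x := fun x => by
    have h1 : HasFDerivAt (fun x : Sp d => x i) (EuclideanSpace.proj i : Sp d →L[ℝ] ℝ) x :=
      (EuclideanSpace.proj i : Sp d →L[ℝ] ℝ).hasFDerivAt
    have h2 := h1.mul ((hdiff hφ) x).hasFDerivAt
    have h3 : fderiv ℝ h x = _ := h2.fderiv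
    simp only [partialD, h3]
    simp
    ring
  have hint : ∀ {p q : Sp d → ℝ}, Continuous p → Continuous q → HasCompactSupport q →
      Integrable (fun x => p x * q x) := fun hp hq hqc =>
    (hp.mul hq).integrable_of_hasCompactSupport hqc.mul_left
  have hparts : ∫ x, h x * partialD φ i x = -∫ x, partialD h i x * φ x :=
    integral_mul_fderiv_eq_neg_fderiv_mul_of_integrable
      (hint (hcd ht) hφ.smooth.continuous hφ.compact)
      (hint ht.smooth.continuous (hcd hφ) (hφ.compact.fderiv_apply ℝ _))
      (hint ht.smooth.continuous hφ.smooth.continuous hφ.compact)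
      (fun x _ => hdiff ht x) (fun x _ => hdiff hφ x)
  have hsplit : ∫ x, partialD h i x * φ x = (∫ x, φ x * φ x) + ∫ x, h x * partialD φ i x := by
    rw [← integral_add (hint hφ.smooth.continuous hφ.smooth.continuous hφ.compact)
      (hint ht.smooth.continuous (hcd hφ) (hφ.compact.fderiv_apply ℝ _))]
    refine integral_congr_ae (Eventually.of_forall fun x => ?_)
    change partialD h i x * φ x = φ x * φ x + h x * partialD φ i x
    rw [hdh]
    simp only [hh]
    ring
  have hzero : ∀ x, x ∉ Ω → φ x = 0 := fun x hx =>
    image_eq_zero_of_notMem_tsupport fun h' => hx (hφ.supp h')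
  have hnorm : ‖v‖ ^ 2 = ∫ x, φ x * φ x := by
    rw [← real_inner_self_eq_norm_sq, L2.inner_def,
      ← setIntegral_eq_integral_of_forall_compl_eq_zero (s := Ω) (f := fun x => φ x * φ x)
        (fun x hx => by rw [hzero x hx, mul_zero])]
    refine integral_congr_ae ?_
    filter_upwards [hv] with x hx
    rw [hx]
    simp [sq]
  have hlhs : ∫ x in Ω, v x * partialD h i x = ∫ x, partialD h i x * φ x := by
    rw [← setIntegral_eq_integral_of_forall_compl_eq_zero (s := Ω)
        (f := fun x => partialD h i x * φ x) (fun x hx => by rw [hzero x hx, mul_zero])]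
    refine integral_congr_ae ?_
    filter_upwards [hv] with x hx
    rw [hx, mul_comm]
  have hrhs : |∫ x in Ω, g x i * h x| ≤ R * (‖g‖ * ‖v‖) := by
    have hb : Integrable (fun x => ‖g x‖ * ‖v x‖) (volume.restrict Ω) :=
      (Lp.memLp g).norm.integrable_mul (Lp.memLp v).norm
    have h1 : ‖∫ x in Ω, g x i * h x‖ ≤ ∫ x in Ω, R * (‖g x‖ * ‖v x‖) := by
      refine norm_integral_le_of_norm_le (hb.const_mul R) ?_
      filter_upwards [hv, ae_restrict_mem hΩ] with x hx hxΩ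
      rw [hx, hh, norm_mul, norm_mul]
      have h2 : ‖g x i‖ ≤ ‖g x‖ := PiLp.norm_apply_le (g x) i
      have h3 : ‖x i‖ ≤ R := hR x hxΩ
      calc ‖g x i‖ * (‖x i‖ * ‖φ x‖) ≤ ‖g x‖ * (R * ‖φ x‖) := by gcongr
        _ = R * (‖g x‖ * ‖φ x‖) := by ring
    rw [integral_const_mul] at h1
    exact h1.trans (by gcongr; exact integral_norm_mul_norm_le g v)
  have hkey := hw i h ht
  rw [hlhs] at hkey
  have h1 := neg_le_of_abs_le hrhs
  have h2 : ‖v‖ * ‖v‖ ≤ (2 * R * ‖g‖) * ‖v‖ := by nlinarith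
  rcases (norm_nonneg v).eq_or_lt with h0 | h0
  · rw [← h0]; positivity
  · exact le_of_mul_le_mul_right h2 h0

/-- Coercivity of the gradient on `H¹₀(Ω)`. -/
theorem exists_coercive_grad (hd : 1 ≤ d) (hΩ : IsOpen Ω) (hΩb : Bornology.IsBounded Ω) :
    ∃ c : ℝ, 0 < c ∧ ∀ v : H10 Ω, c * ‖v‖ ^ 2 ≤ ‖grad Ω v‖ ^ 2 := by
  obtain ⟨R, hR0, hR⟩ := hΩb.exists_pos_norm_le
  have hP : ∀ v : H10 Ω, ‖toL2 Ω v‖ ≤ 2 * R * ‖grad Ω v‖ := by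
    have hcl : IsClosed {p : H1 Ω | ‖p.1.fst‖ ≤ 2 * R * ‖p.1.snd‖} :=
      isClosed_le
        ((WithLp.fstL 2 ℝ (L2 Ω) (L2Vec Ω)).continuous.comp continuous_subtype_val).norm
        (continuous_const.mul
          ((WithLp.sndL 2 ℝ (L2 Ω) (L2Vec Ω)).continuous.comp continuous_subtype_val).norm)
    -- The inequality is a closed condition, so the closure of the test functions inherits it.
    -- Coordinate 0 exists because d ≥ 1.
    have hsub : (testSubmodule Ω : Set (H1 Ω)) ⊆ {p : H1 Ω | ‖p.1.fst‖ ≤ 2 * R * ‖p.1.snd‖} := by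
      rintro p ⟨φ, hφ, hp⟩
      exact norm_le_of_isTest hR0.le ⟨0, hd⟩
        (fun x hx => (PiLp.norm_apply_le x ⟨0, hd⟩).trans (hR x hx)) hΩ.measurableSet p.2 hφ hp
    exact fun v => closure_minimal hsub hcl v.2
  refine ⟨(4 * R ^ 2 + 1)⁻¹, by positivity, fun v => ?_⟩
  rw [inv_mul_le_iff₀ (by positivity), norm_sq_H10]
  have := pow_le_pow_left₀ (norm_nonneg _) (hP v) 2
  nlinarith

end Sobolev

/-! ### Partitions and the piecewise constant and affine reconstructions. -/

section Reconstruction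

variable {N : ℕ} {T : ℝ} {t : ℕ → ℝ}

theorem IsPartition.mono (ht : IsPartition N T t) {m n : ℕ} (hmn : m ≤ n) (hn : n ≤ N) :
    t m ≤ t n := by
  induction n, hmn using Nat.le_induction with
  | base => rfl
  | succ n hmn ih => exact (ih (by omega)).trans (ht.lt n (by omega)).le

theorem IsPartition.nonneg (ht : IsPartition N T t) {n : ℕ} (hn : n ≤ N) : 0 ≤ t n := by
  rw [← ht.zero]
  exact ht.mono n.zero_le hn

theorem IsPartition.exists_mem (ht : IsPartition N T t) {s : ℝ} (hs : s ∈ Ioc 0 T) :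
    ∃ n < N, s ∈ Ioc (t n) (t (n + 1)) := by
  have h : ∀ k ≤ N, s ≤ t k → ∃ n < k, s ∈ Ioc (t n) (t (n + 1)) := by
    intro k
    induction k with
    | zero => intro _ h; rw [ht.zero] at h; exact absurd hs.1 h.not_gt
    | succ k ih =>
      intro hk h
      rcases le_or_gt s (t k) with h' | h'
      · obtain ⟨n, hn, hsn⟩ := ih (by omega) h'
        exact ⟨n, by omega, hsn⟩
      · exact ⟨k, by omega, h', h⟩
  exact h N le_rfl (by rw [ht.last]; exact hs.2)

theorem IsPartition.sum_indicator {V : Type*} [AddCommMonoid V] (ht : IsPartition N T t)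
    (F : ℕ → ℝ → V) {n : ℕ} (hn : n < N) {s : ℝ} (hs : s ∈ Ioc (t n) (t (n + 1))) :
    ∑ m ∈ Finset.range N, (Ioc (t m) (t (m + 1))).indicator (F m) s = F n s := by
  rw [Finset.sum_eq_single_of_mem n (Finset.mem_range.2 hn), indicator_of_mem hs]
  intro m hm hmn
  rw [Finset.mem_range] at hm
  refine indicator_of_notMem (fun h => ?_) _
  rcases lt_or_gt_of_ne hmn with h' | h'
  · have := ht.mono (m := m + 1) (n := n) h' hn.le
    linarith [h.2, hs.1]
  · have := ht.mono (m := n + 1) (n := m) h' hm.le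
    linarith [h.1, hs.2]

theorem pwConst_of_mem {V : Type*} [AddCommGroup V] (ht : IsPartition N T t) (w : ℕ → V) {n : ℕ}
    (hn : n < N) {s : ℝ} (hs : s ∈ Ioc (t n) (t (n + 1))) : pwConst N t w s = w (n + 1) :=
  ht.sum_indicator (fun n _ => w (n + 1)) hn hs

theorem constRecon_of_mem {V : Type*} [AddCommGroup V] (ht : IsPartition N T t) (u : ℕ → V) {n : ℕ}
    (hn : n < N) {s : ℝ} (hs : s ∈ Ioc (t n) (t (n + 1))) : constRecon N t u s = u (n + 1) := by
  have : s ≠ t 0 := ((ht.mono n.zero_le hn.le).trans_lt hs.1).ne'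
  rw [constRecon, Function.update_of_ne this, pwConst_of_mem ht u hn hs]

variable {V : Type*} [NormedAddCommGroup V]

theorem memL2_pwConst (N : ℕ) (T : ℝ) (t : ℕ → ℝ) (w : ℕ → V) : MemL2 T (pwConst N t w) := by
  have : pwConst N t w = fun s => ∑ n ∈ Finset.range N,
      (Ioc (t n) (t (n + 1))).indicator (fun _ => w (n + 1)) s := rfl
  rw [MemL2, this]
  exact memLp_finsetSum _ fun n _ => (memLp_const (w (n + 1))).indicator measurableSet_Ioc

theorem constRecon_ae_eq (ht : IsPartition N T t) (u : ℕ → V) :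
    constRecon N t u =ᵐ[volume.restrict (Ioo 0 T)] pwConst N t u := by
  filter_upwards [ae_restrict_mem measurableSet_Ioo] with s hs
  exact Function.update_of_ne (by rw [ht.zero]; exact hs.1.ne') _ _

theorem memL2_constRecon (ht : IsPartition N T t) (u : ℕ → V) : MemL2 T (constRecon N t u) :=
  (memLp_congr_ae (constRecon_ae_eq ht u)).2 (memL2_pwConst N T t u)

theorem memL2_of_continuousOn {φ : ℝ → V} (h : ContinuousOn φ (Icc 0 T)) : MemL2 T φ := by
  obtain ⟨C, hC⟩ := isCompact_Icc.exists_bound_of_continuousOn h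
  refine MemLp.of_bound ((h.mono Ioo_subset_Icc_self).aestronglyMeasurable measurableSet_Ioo) C ?_
  filter_upwards [ae_restrict_mem measurableSet_Ioo] with s hs
  exact hC s (Ioo_subset_Icc_self hs)

variable [NormedSpace ℝ V]

theorem affineRecon_of_mem (ht : IsPartition N T t) (u : ℕ → V) {n : ℕ} (hn : n < N) {s : ℝ}
    (hs : s ∈ Icc (t n) (t (n + 1))) :
    affineRecon N t u s = ((s - t n) / (t (n + 1) - t n)) • u (n + 1)
      + ((t (n + 1) - s) / (t (n + 1) - t n)) • u n := by
  have hIoc : ∀ m < N, ∀ s ∈ Ioc (t m) (t (m + 1)), affineRecon N t u s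
      = ((s - t m) / (t (m + 1) - t m)) • u (m + 1)
        + ((t (m + 1) - s) / (t (m + 1) - t m)) • u m := fun m hm s hs => by
    have : s ≠ t 0 := ((ht.mono m.zero_le hm.le).trans_lt hs.1).ne'
    rw [affineRecon, Function.update_of_ne this]
    exact ht.sum_indicator (fun n r => ((r - t n) / (t (n + 1) - t n)) • u (n + 1)
        + ((t (n + 1) - r) / (t (n + 1) - t n)) • u n) hm hs
  -- The left node belongs to the preceding piece (or to the special value at `t 0`); both formulas
  -- give u n there, which yields continuity.
  rcases hs.1.eq_or_lt with h | h
  · have hpos : t (n + 1) - t n ≠ 0 := (sub_pos.2 (ht.lt n hn)).ne'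
    have hval : affineRecon N t u (t n) = u n := by
      cases n with
      | zero => exact Function.update_self _ _ _
      | succ m =>
        have hpos' : t (m + 1) - t m ≠ 0 := (sub_pos.2 (ht.lt m (by omega))).ne'
        rw [hIoc m (by omega) _ (right_mem_Ioc.2 (ht.lt m (by omega)))]
        simp [div_self hpos']
    rw [← h, hval]
    simp [div_self hpos]
  · exact hIoc n hn s ⟨h, hs.2⟩

theorem continuousOn_affineRecon (ht : IsPartition N T t) (u : ℕ → V) :
    ContinuousOn (affineRecon N t u) (Icc 0 T) := by
  have h : ∀ k ≤ N, ContinuousOn (affineRecon N t u) (Icc 0 (t k)) := by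
    intro k
    induction k with
    | zero =>
      intro _
      rw [ht.zero, Icc_self]
      exact continuousOn_singleton _ _
    | succ k ih =>
      intro hk
      rw [← Icc_union_Icc_eq_Icc (ht.nonneg (Nat.le_of_succ_le hk)) (ht.lt k hk).le]
      refine (ih (by omega)).union_of_isClosed ?_ isClosed_Icc isClosed_Icc
      refine ContinuousOn.congr (Continuous.continuousOn ?_)
        (fun s hs => affineRecon_of_mem ht u hk hs)
      fun_prop
  rw [← ht.last]
  exact h N le_rfl

theorem hasDerivAt_affineRecon (ht : IsPartition N T t) (u : ℕ → V) {n : ℕ} (hn : n < N) {s : ℝ}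
    (hs : s ∈ Ioo (t n) (t (n + 1))) :
    HasDerivAt (affineRecon N t u) ((t (n + 1) - t n)⁻¹ • (u (n + 1) - u n)) s := by
  have h1 : HasDerivAt (fun s => ((s - t n) / (t (n + 1) - t n)) • u (n + 1)
      + ((t (n + 1) - s) / (t (n + 1) - t n)) • u n)
      ((1 / (t (n + 1) - t n)) • u (n + 1) + (-1 / (t (n + 1) - t n)) • u n) s :=
    ((((hasDerivAt_id s).sub_const _).div_const _).smul_const _).add
      ((((hasDerivAt_id s).const_sub _).div_const _).smul_const _)
  have h2 : (1 / (t (n + 1) - t n)) • u (n + 1) + (-1 / (t (n + 1) - t n)) • u n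
      = (t (n + 1) - t n)⁻¹ • (u (n + 1) - u n) := by
    rw [smul_sub, neg_div, neg_smul, one_div, ← sub_eq_add_neg]
  rw [← h2]
  refine h1.congr_of_eventuallyEq ?_
  filter_upwards [isOpen_Ioo.mem_nhds hs] with r hr
  exact affineRecon_of_mem ht u hn (Ioo_subset_Icc_self hr)

/-- The difference quotients `(u_n - u_{n-1})/τ_n`, indexed by `n`. -/
def diffQuot (t : ℕ → ℝ) (u : ℕ → V) (n : ℕ) : V := (t n - t (n - 1))⁻¹ • (u n - u (n - 1))

/-- Off the nodes the slope is the difference quotient. Continuity and countability of the nodes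
give the fundamental theorem of calculus, so the reconstruction is a primitive up to a constant and
no jump terms arise. -/
theorem isWeakDeriv_affineRecon [CompleteSpace V] (hT : 0 < T) (ht : IsPartition N T t)
    (u : ℕ → V) : IsWeakDeriv T (affineRecon N t u) (pwConst N t (diffQuot t u)) := by
  have hc := continuousOn_affineRecon ht u
  have hk := intervalIntegrable_of_memL2 hT (memL2_pwConst N T t (diffQuot t u))
  have hd : ∀ x ∈ Ioo 0 T \ range t,
      HasDerivAt (affineRecon N t u) (pwConst N t (diffQuot t u) x) x := by
    rintro x ⟨hx, hxt⟩
    obtain ⟨n, hn, hxn⟩ := ht.exists_mem (Ioo_subset_Ioc_self hx)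
    rw [pwConst_of_mem ht _ hn hxn]
    exact hasDerivAt_affineRecon ht u hn ⟨hxn.1, hxn.2.lt_of_ne fun h => hxt ⟨_, h.symm⟩⟩
  have hprim : ∀ x ∈ uIcc 0 T, ∫ s in (0 : ℝ)..x, pwConst N t (diffQuot t u) s
      = affineRecon N t u x - affineRecon N t u 0 := fun x hx => by
    have hx' : x ∈ Icc 0 T := by rwa [uIcc_of_le hT.le] at hx
    exact integral_eq_of_hasDerivAt_off_countable_of_le _ _ hx'.1 (countable_range t)
      (hc.mono (Icc_subset_Icc_right hx'.2))
      (fun y hy => hd y ⟨⟨hy.1.1, hy.1.2.trans_le hx'.2⟩, hy.2⟩)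
      (hk.mono_set (uIcc_subset_uIcc left_mem_uIcc hx))
  refine isWeakDeriv_of_absolutelyContinuous hT
    (hk.absolutelyContinuousOnInterval_primitive.of_dist_le fun x hx y hy => ?_) hk ?_
  · rw [hprim x hx, hprim y hy, dist_sub_right]
  · have h0 : ∀ᵐ x : ℝ, x ∉ range t :=
      measure_eq_zero_iff_ae_notMem.1 ((countable_range t).measure_zero volume)
    have h1 : ∀ᵐ x : ℝ, x ≠ 0 := by simp [ae_iff, measure_singleton]
    have h2 : ∀ᵐ x : ℝ, x ≠ T := by simp [ae_iff, measure_singleton]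
    filter_upwards [h0, h1, h2] with x hx hx0 hxT hxI
    rw [uIcc_of_le hT.le] at hxI
    exact hd x ⟨⟨hxI.1.lt_of_ne hx0.symm, hxI.2.lt_of_ne hxT⟩, hx⟩

end Reconstruction

/-! ### The embedding of V into its dual, and Minkowski's inequality. -/

section DualEmbedding

variable {V K : Type*} [NormedAddCommGroup V] [InnerProductSpace ℝ V] [CompleteSpace V]
  [NormedAddCommGroup K] [InnerProductSpace ℝ K] [CompleteSpace K]

omit [CompleteSpace V] [CompleteSpace K] in
/-- The map `V → V'`, `v ↦ (g v, g ·)`. -/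
def dualEmb (g : V →L[ℝ] K) : V →L[ℝ] StrongDual ℝ V :=
  LinearMap.mkContinuous
    { toFun := fun v => (innerSL ℝ (g v)).comp g
      map_add' := fun v w => by ext; simp
      map_smul' := fun c v => by ext; simp } (‖g‖ * ‖g‖) fun v => by
    refine (ContinuousLinearMap.opNorm_comp_le _ _).trans ?_
    rw [innerSL_apply_norm, mul_right_comm]
    gcongr
    exact g.le_opNorm v

omit [CompleteSpace V] [CompleteSpace K] in
theorem dualEmb_apply (g : V →L[ℝ] K) (v w : V) : dualEmb g v w = inner ℝ (g v) (g w) := rfl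

theorem rieszL_dualEmb (g : V →L[ℝ] K) (v : V) : rieszL V (dualEmb g v) = gramOp g v := by
  refine ext_inner_right ℝ fun w => ?_
  rw [inner_rieszL, inner_gramOp, dualEmb_apply]

/-- Both sides represent the same functional, and coercivity makes representatives unique. -/
theorem formRiesz_dualEmb {g : V →L[ℝ] K} {c : ℝ} (hc : 0 < c)
    (hg : ∀ v, c * ‖v‖ ^ 2 ≤ ‖g v‖ ^ 2) (v : V) : formRiesz g (dualEmb g v) = v := by
  have h := hg (formRiesz g (dualEmb g v) - v)
  have h0 : ∀ w, inner ℝ (g (formRiesz g (dualEmb g v) - v)) (g w) = 0 := fun w => by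
    rw [map_sub, inner_sub_left, inner_formRiesz hc hg, dualEmb_apply, sub_self]
  rw [← real_inner_self_eq_norm_sq (g _), h0] at h
  have h1 : ‖formRiesz g (dualEmb g v) - v‖ ^ 2 = 0 :=
    le_antisymm (nonpos_of_mul_nonpos_right h hc) (sq_nonneg _)
  rwa [sq_eq_zero_iff, norm_eq_zero, sub_eq_zero] at h1

omit [CompleteSpace K] in
theorem sqrt_integral_norm_sq {α : Type*} [MeasurableSpace α] {μ : Measure α} {a : α → K}
    (ha : MemLp a 2 μ) : Real.sqrt (∫ x, ‖a x‖ ^ 2 ∂μ) = ‖ha.toLp a‖ := by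
  rw [Real.sqrt_eq_iff_mul_self_eq (integral_nonneg fun x => sq_nonneg _) (norm_nonneg _),
    ← real_inner_self_eq_norm_mul_norm, L2.inner_def]
  refine integral_congr_ae ?_
  filter_upwards [ha.coeFn_toLp] with x hx
  rw [hx, real_inner_self_eq_norm_sq]

omit [CompleteSpace K] in
theorem sqrt_integral_norm_sq_add_le {α : Type*} [MeasurableSpace α] {μ : Measure α} {a b : α → K}
    (ha : MemLp a 2 μ) (hb : MemLp b 2 μ) :
    Real.sqrt (∫ x, ‖a x + b x‖ ^ 2 ∂μ)
      ≤ Real.sqrt (∫ x, ‖a x‖ ^ 2 ∂μ) + Real.sqrt (∫ x, ‖b x‖ ^ 2 ∂μ) := by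
  rw [sqrt_integral_norm_sq ha, sqrt_integral_norm_sq hb]
  refine (sqrt_integral_norm_sq (ha.add hb)).le.trans ?_
  rw [MemLp.toLp_add]
  exact norm_add_le _ _

end DualEmbedding

/-! ### The error estimate in an abstract Gelfand triple. -/

section AbstractParabolic

variable {V H K : Type*} [NormedAddCommGroup V] [InnerProductSpace ℝ V] [CompleteSpace V]
  [NormedAddCommGroup H] [InnerProductSpace ℝ H] [CompleteSpace H]
  [NormedAddCommGroup K] [InnerProductSpace ℝ K] [CompleteSpace K]
  {i : V →L[ℝ] H} {g : V →L[ℝ] K} {c T : ℝ}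

theorem MemL2.clm {V W : Type*} [NormedAddCommGroup V] [NormedSpace ℝ V] [NormedAddCommGroup W]
    [NormedSpace ℝ W] {φ : ℝ → V} (h : MemL2 T φ) (L : V →L[ℝ] W) : MemL2 T fun t => L (φ t) :=
  L.comp_memLp' h

variable (i) in
/-- `w ∈ L²(0,T;V')` is the weak derivative of the `V`-valued function `φ`, regarded as a
`V'`-valued function. -/
def IsDualDeriv (T : ℝ) (φ : ℝ → V) (w : ℝ → StrongDual ℝ V) : Prop :=
  MemL2 T w ∧ IsWeakDeriv T (fun t => (innerSL ℝ (i (φ t))).comp i) w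

/-- The dual norm of a functional with respect to the norm `‖g v‖`. -/
def formDualNorm (g : V →L[ℝ] K) (Φ : StrongDual ℝ V) : ℝ :=
  sSup {r : ℝ | ∃ v : V, v ≠ 0 ∧ r = Φ v / ‖g v‖}

variable (i) in
/-- `r` is a continuous `H`-valued representative of `φ`. -/
def IsContRepOf (T : ℝ) (φ : ℝ → V) (r : ℝ → H) : Prop :=
  ContinuousOn r (Icc 0 T) ∧ ∀ᵐ t ∂(volume.restrict (Ioo 0 T)), r t = i (φ t)

/-- **Lions–Magenes**, for a weak derivative in the dual space. -/
theorem IsDualDeriv.exists_isContRepOf {φ : ℝ → V} {w : ℝ → StrongDual ℝ V}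
    (hw : IsDualDeriv i T φ w) (hi : Function.Injective i) (hT : 0 < T) (hφ : MemL2 T φ) :
    ∃ r : ℝ → H, IsContRepOf i T φ r ∧
      ‖r T‖ ^ 2 - ‖r 0‖ ^ 2 = ∫ t in Ioo 0 T, 2 * w t (φ t) := by
  -- The Riesz map of V's own inner product turns the embedding V → V' into i*i, the form required
  -- by the energy identity.
  have h1 : IsWeakDeriv T (fun t => rieszL V (dualEmb i (φ t))) fun t => rieszL V (w t) :=
    hw.2.clm (rieszL V) (integrable_of_memL2 (hφ.clm (dualEmb i))) (integrable_of_memL2 hw.1)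
  simp only [rieszL_dualEmb] at h1
  obtain ⟨r, hc1, hc2, hc3⟩ := exists_continuous_rep_energy hi hT hφ (hw.1.clm (rieszL V)) h1
  refine ⟨r, ⟨hc1, hc2⟩, hc3.trans (integral_congr_ae (Eventually.of_forall fun t => ?_))⟩
  change 2 * inner ℝ (φ t) (rieszL V (w t)) = 2 * w t (φ t)
  rw [real_inner_comm, inner_rieszL]

omit [CompleteSpace V] [CompleteSpace H] in
theorem IsContRepOf.eqOn {φ : ℝ → V} (hT : 0 < T) {r₁ r₂ : ℝ → H} (h₁ : IsContRepOf i T φ r₁)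
    (h₂ : IsContRepOf i T φ r₂) : EqOn r₁ r₂ (Icc 0 T) := by
  refine Measure.eqOn_Icc_of_ae_eq volume hT.ne ?_ h₁.1 h₂.1
  rw [← restrict_Ioo_eq_restrict_Icc]
  filter_upwards [h₁.2, h₂.2] with t h h'
  rw [h, h']

omit [CompleteSpace V] [CompleteSpace H] in
theorem IsDualDeriv.ae_eq {φ : ℝ → V} {w₁ w₂ : ℝ → StrongDual ℝ V} (h₁ : IsDualDeriv i T φ w₁)
    (h₂ : IsDualDeriv i T φ w₂) : w₁ =ᵐ[volume.restrict (Ioo 0 T)] w₂ :=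
  h₁.2.ae_unique h₂.2 (integrable_of_memL2 h₁.1) (integrable_of_memL2 h₂.1)

omit [CompleteSpace V] [CompleteSpace H] in
theorem IsDualDeriv.sub {φ₁ φ₂ : ℝ → V} {w₁ w₂ : ℝ → StrongDual ℝ V} (h₁ : IsDualDeriv i T φ₁ w₁)
    (h₂ : IsDualDeriv i T φ₂ w₂) (hφ₁ : MemL2 T φ₁) (hφ₂ : MemL2 T φ₂) :
    IsDualDeriv i T (φ₁ - φ₂) (fun t => w₁ t - w₂ t) := by
  refine ⟨h₁.1.sub h₂.1, ?_⟩
  have h : IsWeakDeriv T (fun t => dualEmb i (φ₁ t) - dualEmb i (φ₂ t)) (fun t => w₁ t - w₂ t) :=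
    h₁.2.sub h₂.2 (integrable_of_memL2 (hφ₁.clm (dualEmb i)))
    (integrable_of_memL2 (hφ₂.clm (dualEmb i))) (integrable_of_memL2 h₁.1)
    (integrable_of_memL2 h₂.1)
  simp only [← map_sub] at h
  exact h

omit [CompleteSpace H] in
/-- The weak derivative of the piecewise affine reconstruction. -/
theorem isDualDeriv_affineRecon (i : V →L[ℝ] H) (hT : 0 < T) {N : ℕ} {t : ℕ → ℝ}
    (ht : IsPartition N T t) (u : ℕ → V) : IsDualDeriv i T (affineRecon N t u)
      (fun s => dualEmb i (pwConst N t (diffQuot t u) s)) :=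
  ⟨(memL2_pwConst N T t _).clm _, (isWeakDeriv_affineRecon hT ht u).clm (dualEmb i)
    (integrable_of_memL2 (memL2_of_continuousOn (continuousOn_affineRecon ht u)))
    (integrable_of_memL2 (memL2_pwConst N T t _))⟩

/-- For `φ` with `φ(0) = 0`, the parabolic norm is the norm of the residual. -/
theorem IsDualDeriv.sqrt_eq_residual {φ : ℝ → V} {w : ℝ → StrongDual ℝ V}
    (hw : IsDualDeriv i T φ w) (hi : Function.Injective i) (hT : 0 < T) (hc : 0 < c)
    (hg : ∀ v, c * ‖v‖ ^ 2 ≤ ‖g v‖ ^ 2) (hφ : MemL2 T φ) {r : ℝ → H} (hr : IsContRepOf i T φ r)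
    (h0 : r 0 = 0) :
    Real.sqrt ((∫ t in Ioo 0 T, (formDualNorm g (w t) ^ 2 + ‖g (φ t)‖ ^ 2)) + ‖r T‖ ^ 2)
      = Real.sqrt (∫ t in Ioo 0 T, ‖g (formRiesz g (w t) + φ t)‖ ^ 2) := by
  obtain ⟨r', hr', hen⟩ := hw.exists_isContRepOf hi hT hφ
  rw [hr'.eqOn hT hr (left_mem_Icc.2 hT.le), hr'.eqOn hT hr (right_mem_Icc.2 hT.le), h0,
    norm_zero] at hen
  have hdn : ∀ Φ, formDualNorm g Φ = ‖g (formRiesz g Φ)‖ := sSup_dual_eq_norm_formRiesz hc hg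
  have hexp : ∀ t, ‖g (formRiesz g (w t) + φ t)‖ ^ 2
      = (formDualNorm g (w t) ^ 2 + ‖g (φ t)‖ ^ 2) + 2 * w t (φ t) := fun t => by
    rw [map_add, norm_add_sq_real, inner_formRiesz hc hg, hdn]
    ring
  have hi1 : Integrable (fun t => formDualNorm g (w t) ^ 2) (volume.restrict (Ioo 0 T)) := by
    simp only [hdn]
    exact ((hw.1.clm (formRiesz g)).clm g).norm.integrable_sq
  have hi2 : Integrable (fun t => ‖g (φ t)‖ ^ 2) (volume.restrict (Ioo 0 T)) :=
    (hφ.clm g).norm.integrable_sq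
  -- The duality pairing is recovered from integrable squares by polarisation.
  have hi3 : Integrable (fun t => 2 * w t (φ t)) (volume.restrict (Ioo 0 T)) := by
    have h1 : Integrable (fun t => ‖g (formRiesz g (w t) + φ t)‖ ^ 2)
        (volume.restrict (Ioo 0 T)) :=
      (MemL2.clm ((hw.1.clm (formRiesz g)).add hφ) g).norm.integrable_sq
    refine (h1.sub (hi1.add hi2)).congr (Eventually.of_forall fun t => ?_)
    simp only [Pi.sub_apply, Pi.add_apply, hexp]
    ring
  simp only [hexp]
  rw [integral_add (hi1.fun_add hi2) hi3, ← hen]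
  simp

/-- The a posteriori error identity for the implicit Euler method, in an abstract Gelfand triple,
with the resulting upper and lower bounds. -/
theorem euler_error_bounds (hi : Function.Injective i) (hT : 0 < T) (hc : 0 < c)
    (hg : ∀ v, c * ‖v‖ ^ 2 ≤ ‖g v‖ ^ 2) {f wu we : ℝ → StrongDual ℝ V} (hf : MemL2 T f)
    {u : ℝ → V} (hu : MemL2 T u) (hwu : IsDualDeriv i T u wu)
    (heqn : ∀ v, ∀ᵐ s ∂(volume.restrict (Ioo 0 T)), wu s v + inner ℝ (g (u s)) (g v) = f s v)
    {N : ℕ} {t : ℕ → ℝ} (ht : IsPartition N T t) {fn : ℕ → StrongDual ℝ V} {un : ℕ → V}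
    (hun : ∀ n < N, ∀ v, inner ℝ (i ((t (n + 1) - t n)⁻¹ • (un (n + 1) - un n))) (i v)
      + inner ℝ (g (un (n + 1))) (g v) = fn (n + 1) v)
    (hwe : IsDualDeriv i T (u - affineRecon N t un) we) {r : ℝ → H}
    (hr : IsContRepOf i T (u - affineRecon N t un) r) (h0 : r 0 = 0) :
    Real.sqrt ((∫ s in Ioo 0 T, (formDualNorm g (we s) ^ 2
        + ‖g ((u - affineRecon N t un) s)‖ ^ 2)) + ‖r T‖ ^ 2)
      ≤ Real.sqrt (∫ s in Ioo 0 T, ‖g ((constRecon N t un - affineRecon N t un) s)‖ ^ 2)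
        + Real.sqrt (∫ s in Ioo 0 T, formDualNorm g ((f - pwConst N t fn) s) ^ 2) ∧
    Real.sqrt (∫ s in Ioo 0 T, ‖g ((constRecon N t un - affineRecon N t un) s)‖ ^ 2)
      ≤ Real.sqrt ((∫ s in Ioo 0 T, (formDualNorm g (we s) ^ 2
        + ‖g ((u - affineRecon N t un) s)‖ ^ 2)) + ‖r T‖ ^ 2)
        + Real.sqrt (∫ s in Ioo 0 T, formDualNorm g ((f - pwConst N t fn) s) ^ 2) := by
  have hU := memL2_of_continuousOn (continuousOn_affineRecon ht un)
  have hjump : MemL2 T (constRecon N t un - affineRecon N t un) := (memL2_constRecon ht un).sub hU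
  have hF : MemL2 T (f - pwConst N t fn) := hf.sub (memL2_pwConst N T t fn)
  have he : MemL2 T (u - affineRecon N t un) := hu.sub hU
  have hwe' := hwu.sub (isDualDeriv_affineRecon i hT ht un) hu hU
  set e := u - affineRecon N t un with hedef
  set j := constRecon N t un - affineRecon N t un with hjdef
  set F := f - pwConst N t fn with hFdef
  -- The residual equation. On each subinterval e - j = u - u_{n+1}, so subtracting the Euler
  -- equation leaves ⟨w_e, v⟩ + (g(e - j), g v) = ⟨F, v⟩.
  have hres : ∀ᵐ s ∂(volume.restrict (Ioo 0 T)),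
      formRiesz g (we s) + e s = j s + formRiesz g (F s) := by
    have hG : MemL2 T fun s => we s - F s + dualEmb g (e s - j s) :=
      (hwe.1.sub hF).add (MemL2.clm (he.sub hjump) (dualEmb g))
    have hae := formRiesz_ae_eq_zero hc hg hG.1 fun v => by
      filter_upwards [hwe.ae_eq hwe', heqn v, ae_restrict_mem measurableSet_Ioo] with s h1 h2 hs
      obtain ⟨n, hn, hsn⟩ := ht.exists_mem (Ioo_subset_Ioc_self hs)
      have h3 := hun n hn v
      have h4 : e s - j s = u s - un (n + 1) := by
        simp only [hedef, hjdef, Pi.sub_apply, constRecon_of_mem ht un hn hsn]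
        abel
      rw [h1, h4]
      simp only [hFdef, Pi.sub_apply, pwConst_of_mem ht _ hn hsn, diffQuot, add_tsub_cancel_right,
        add_apply, sub_apply, dualEmb_apply, map_sub g, inner_sub_left] at h3 ⊢
      linarith
    filter_upwards [hae] with s hs
    rw [map_add, map_sub, formRiesz_dualEmb hc hg] at hs
    rw [← sub_eq_zero, ← hs]
    abel
  have hY : Real.sqrt ((∫ s in Ioo 0 T, (formDualNorm g (we s) ^ 2 + ‖g (e s)‖ ^ 2)) + ‖r T‖ ^ 2)
      = Real.sqrt (∫ s in Ioo 0 T, ‖g (j s) + g (formRiesz g (F s))‖ ^ 2) := by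
    rw [hwe.sqrt_eq_residual hi hT hc hg he hr h0]
    congr 1
    refine integral_congr_ae ?_
    filter_upwards [hres] with s hs
    rw [← map_add, ← hs]
  have hFn : Real.sqrt (∫ s in Ioo 0 T, formDualNorm g (F s) ^ 2)
      = Real.sqrt (∫ s in Ioo 0 T, ‖g (formRiesz g (F s))‖ ^ 2) := by
    simp only [formDualNorm, sSup_dual_eq_norm_formRiesz hc hg]
  have hga := hjump.clm g
  have hFa := (hF.clm (formRiesz g)).clm g
  rw [hY, hFn]
  refine ⟨sqrt_integral_norm_sq_add_le hga hFa, ?_⟩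
  -- The lower bound writes j as (j + RF) - RF.
  have h := sqrt_integral_norm_sq_add_le (hga.add hFa) hFa.neg
  simpa only [Pi.add_apply, Pi.neg_apply, add_neg_cancel_right, norm_neg] using h

end AbstractParabolic

/-! ### Specialisation to H¹₀, L² and the gradient. -/

section Parabolic

variable {d : ℕ} {Ω : Set (Sp d)} {T : ℝ} {φ : ℝ → H10 Ω}

/-! Shortcut instances, which keep unification through the nested submodules fast. -/

local instance normedAddCommGroup_H10 : NormedAddCommGroup (H10 Ω) := Submodule.normedAddCommGroup _

local instance innerProductSpace_H10 : InnerProductSpace ℝ (H10 Ω) := Submodule.innerProductSpace _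

local instance normedSpace_H10 : NormedSpace ℝ (H10 Ω) := Submodule.normedSpace _

theorem isTimeDeriv_iff {w : ℝ → Hm1 Ω} : IsTimeDeriv T φ w ↔ IsDualDeriv (toL2 Ω) T φ w :=
  Iff.rfl

theorem isContRep_iff {r : ℝ → L2 Ω} : IsContRep T φ r ↔ IsContRepOf (toL2 Ω) T φ r :=
  Iff.rfl

/-- Continuous functions that agree a.e. agree on [0, T], endpoints included, so the chosen
representative does not matter. -/
theorem valueAt_eq (hT : 0 < T) {r : ℝ → L2 Ω} (h : IsContRep T φ r) {t : ℝ}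
    (ht : t ∈ Icc 0 T) : valueAt T φ t = r t := by
  have hex : ∃ r : ℝ → L2 Ω, IsContRep T φ r := ⟨r, h⟩
  rw [valueAt, dif_pos hex]
  exact (isContRep_iff.1 hex.choose_spec).eqOn hT (isContRep_iff.1 h) ht

theorem isTimeDeriv_timeDeriv (h : MemY T φ) : IsTimeDeriv T φ (timeDeriv T φ) := by
  rw [timeDeriv, dif_pos h.2]
  exact h.2.choose_spec

theorem exists_isContRep (hΩ : IsOpen Ω) (hT : 0 < T) (h : MemY T φ) :
    ∃ r : ℝ → L2 Ω, IsContRep T φ r := by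
  obtain ⟨r, hr, -⟩ := (isTimeDeriv_iff.1 (isTimeDeriv_timeDeriv h)).exists_isContRepOf
    (injective_toL2 hΩ) hT h.1
  exact ⟨r, isContRep_iff.2 hr⟩

set_option maxHeartbeats 1000000 in
/-- The a posteriori error bounds for the implicit Euler approximation of the heat equation. -/
theorem IsWeakSolution.euler_error_bounds (hd : 1 ≤ d) (hΩ : IsOpen Ω)
    (hΩb : Bornology.IsBounded Ω) (hT : 0 < T) {f : ℝ → Hm1 Ω} (hf : MemL2 T f) (u₀ : H10 Ω)
    {u : ℝ → H10 Ω} (hu : IsWeakSolution T f (toL2 Ω u₀) u)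
    {N : ℕ} {t : ℕ → ℝ} (ht : IsPartition N T t)
    (fn : ℕ → Hm1 Ω) {un : ℕ → H10 Ω} (hun0 : un 0 = u₀) (hun : IsImplicitEuler N t fn un) :
    MemL2 T (constRecon N t un - affineRecon N t un) ∧
    MemY T (u - affineRecon N t un) ∧
    (∃ c : ℝ → L2 Ω, IsContRep T (u - affineRecon N t un) c) ∧
    MemL2 T (f - pwConst N t fn) ∧
    normY T (u - affineRecon N t un)
      ≤ normX T (constRecon N t un - affineRecon N t un) + normL2Hm1 T (f - pwConst N t fn) ∧
    normX T (constRecon N t un - affineRecon N t un)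
      ≤ normY T (u - affineRecon N t un) + normL2Hm1 T (f - pwConst N t fn) := by
  obtain ⟨c, hc, hg⟩ := exists_coercive_grad hd hΩ hΩb
  have hUc := continuousOn_affineRecon ht un
  have hU := memL2_of_continuousOn hUc
  have hwu := isTimeDeriv_timeDeriv hu.memY
  have he : MemY T (u - affineRecon N t un) := ⟨hu.memY.1.sub hU, _, isTimeDeriv_iff.2
    ((isTimeDeriv_iff.1 hwu).sub (isDualDeriv_affineRecon (toL2 Ω) hT ht un) hu.memY.1 hU)⟩
  obtain ⟨cu, hcu⟩ := exists_isContRep hΩ hT hu.memY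
  have hce : IsContRep T (u - affineRecon N t un)
      (fun s => cu s - toL2 Ω (affineRecon N t un s)) := by
    refine ⟨hcu.1.sub ((toL2 Ω).continuous.comp_continuousOn hUc), ?_⟩
    filter_upwards [hcu.2] with s hs
    rw [hs, Pi.sub_apply, map_sub]
  have hU0 : affineRecon N t un 0 = un 0 := by
    rw [affineRecon, ← ht.zero, Function.update_self]
  -- The exact solution and the Euler scheme share the initial value, so the error starts at zero.
  have h0 : cu 0 - toL2 Ω (affineRecon N t un 0) = 0 := by
    rw [← valueAt_eq hT hcu (left_mem_Icc.2 hT.le), hu.init, hU0, hun0, sub_self]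
  have key := HeatEuler.euler_error_bounds (injective_toL2 hΩ) hT hc hg hf hu.memY.1 (isTimeDeriv_iff.1 hwu)
    hu.eqn ht hun (isTimeDeriv_iff.1 (isTimeDeriv_timeDeriv he)) (isContRep_iff.1 hce) h0
  refine ⟨(memL2_constRecon ht un).sub hU, he, ⟨_, hce⟩, hf.sub (memL2_pwConst N T t fn), ?_⟩
  rw [normY, valueAt_eq hT hce (right_mem_Icc.2 hT.le)]
  exact key

end Parabolic

end HeatEuler

end

open HeatEuler

theorem mainTheorem7 {d : ℕ} (hd : 1 ≤ d) {Ω : Set (EuclideanSpace ℝ (Fin d))}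
    (hΩ : IsOpen Ω) (hΩb : Bornology.IsBounded Ω) (hΩne : Ω.Nonempty)
    {T : ℝ} (hT : 0 < T)
    -- data and exact solution
    {f : ℝ → Hm1 Ω} (hf : MemL2 T f) (u₀ : H10 Ω)
    {u : ℝ → H10 Ω} (hu : IsWeakSolution T f (toL2 Ω u₀) u)
    -- time partition and implicit Euler approximations
    {N : ℕ} (hN : 1 ≤ N) {t : ℕ → ℝ} (ht : IsPartition N T t)
    (fn : ℕ → Hm1 Ω) {un : ℕ → H10 Ω} (hun0 : un 0 = u₀) (hun : IsImplicitEuler N t fn un) :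
    -- the functions whose norms are compared lie in the respective spaces
    MemL2 T (constRecon N t un - affineRecon N t un) ∧
    MemY T (u - affineRecon N t un) ∧
    (∃ c : ℝ → L2 Ω, IsContRep T (u - affineRecon N t un) c) ∧
    MemL2 T (f - pwConst N t fn) ∧
    -- upper bound
    normY T (u - affineRecon N t un)
      ≤ normX T (constRecon N t un - affineRecon N t un) + normL2Hm1 T (f - pwConst N t fn) ∧
    -- lower bound
    normX T (constRecon N t un - affineRecon N t un)
      ≤ normY T (u - affineRecon N t un) + normL2Hm1 T (f - pwConst N t fn) := by
  exact hu.euler_error_bounds hd hΩ hΩb hT hf u₀ ht fn hun0 hun
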